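/- Let $k$ be an infinite field, $R=k[x_1,\dots,x_d]$ with its standard grading, and let $I\subset R$ be a homogeneous ideal with $I\neq 0$ and $I\neq R$. For a finitely generated graded $R$-module $M$ put $\operatorname{reg}(M)=\max\{j-i\mid \operatorname{Tor}_i^R(M,k)_j\neq 0\}$, with $\operatorname{reg}(0)=-\infty$. To $\gamma=(g_{ij})\in \operatorname{GL}_d(k)$ associate the linear forms $\ell_i=\sum_{j=1}^d g_{ij}x_j$ and, for $0\le t\le d$, the module $M^{(t)}=R/(I+(\ell_{t+1},\dots,\ell_d))$. The sequence $\ell_d,\dots,\ell_1$ is called almost regular on $R/I$ if $0:_{M^{(t)}}\ell_t=\{m\in M^{(t)}\mid \ell_t m=0\}$ is a finite dimensional $k$-vector space for all $1\le t\le d$; in that case its annihilator numbers are $\alpha_{sj}(R/I)=\dim_k(0:_{M^{(d-s)}}\ell_{d-s})_j$ for $0\le s\le d-1$ and $j\ge 0$. For $0\le i\le d$ the sectional regularity $\operatorname{sreg}_i(I)$ is the common value of $\operatorname{reg}(I+(\ell_{i+1},\dots,\ell_d))$ for all $\gamma$ in some nonempty Zariski open subset of $\operatorname{GL}_d(k)$.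 Then the following hold. (1) There is a nonempty Zariski open subset $U\subseteq\operatorname{GL}_d(k)$ such that for every $\gamma\in U$ the sequence $\ell_d,\dots,\ell_1$ is almost regular on $R/I$, one has $\operatorname{sreg}_i(I)=\operatorname{reg}(I+(\ell_{i+1},\dots,\ell_d))$ for all $0\le i\le d$ (in particular $\operatorname{sreg}_i(I)$ is well defined), and for all $1\le i\le d$ \[ \operatorname{sreg}_i(I)=\max\{\operatorname{reg}(0:_{M^{(t)}}\ell_t)\mid 1\le t\le i\}+1=\max\{j\mid \alpha_{sj}(R/I)\neq 0 \text{ for some } s \text{ with } d-i\le s\le d-1\}+1, \] where both maxima exist and are nonnegative integers. (2) For every $\gamma\in\operatorname{GL}_d(k)$ such that $\ell_d,\dots,\ell_1$ is almost regular on $R/I$, the two equalities in (1) hold for all $1\le i\le d$ with $\operatorname{reg}(I+(\ell_{i+1},\dots,\ell_d))$, formed with these $\ell$'s, in place of $\operatorname{sreg}_i(I)$. (3) Consequently $\operatorname{sreg}_1(I)\le \operatorname{sreg}_2(I)\le\dots\le\operatorname{sreg}_d(I)$. -/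

import Mathlib

open MvPolynomial

attribute [local instance] MvPolynomial.gradedAlgebra

namespace SectReg

section Koszul

variable {k : Type*} [Field k] {d : ℕ}
variable {M : Type*} [AddCommGroup M] [Module (MvPolynomial (Fin d) k) M]

/-- The differential of the Koszul complex `K(x_1, …, x_d) ⊗ M` over `R = k[x_1, …, x_d]`.
An element of the complex is written `∑_s z(s) e_s`, where `s = {b_1 < ⋯ < b_i}` runs over the
subsets of the set of variables and `e_s = e_{b_1} ∧ ⋯ ∧ e_{b_i}` sits in homological degree
`i = |s|`; the differential is the usual one, `e_s ↦ ∑_r (-1)^(r-1) x_{b_r} e_{s \ {b_r}}`. -/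
noncomputable def koszulD :
    (Finset (Fin d) → M) →ₗ[MvPolynomial (Fin d) k] (Finset (Fin d) → M) where
  toFun z s := ∑ a ∈ sᶜ,
    ((-1 : MvPolynomial (Fin d) k) ^ (s.filter (· < a)).card * X a) • z (insert a s)
  map_add' z w := by
    funext s
    simp [smul_add, Finset.sum_add_distrib]
  map_smul' c z := by
    funext s
    simp only [Pi.smul_apply, RingHom.id_apply, Finset.smul_sum]
    exact Finset.sum_congr rfl fun a _ => smul_comm _ _ _

/-- The Koszul differential squares to zero. -/
theorem koszulD_koszulD (z : Finset (Fin d) → M) :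
    koszulD (k := k) (koszulD (k := k) z) = 0 := by
  funext s
  simp only [koszulD, LinearMap.coe_mk, AddHom.coe_mk, Pi.zero_apply, Finset.smul_sum, smul_smul]
  rw [Finset.sum_sigma']
  have key : ∀ a b : Fin d, a < b → a ∉ s →
      ((-1 : MvPolynomial (Fin d) k) ^ (s.filter (· < a)).card * X a *
        ((-1) ^ ((insert a s).filter (· < b)).card * X b)) +
      ((-1 : MvPolynomial (Fin d) k) ^ (s.filter (· < b)).card * X b *
        ((-1) ^ ((insert b s).filter (· < a)).card * X a)) = 0 := by
    intro a b hab ha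
    have h1 : ((insert a s).filter (· < b)).card = (s.filter (· < b)).card + 1 := by
      rw [Finset.filter_insert, if_pos hab, Finset.card_insert_of_notMem]
      simp [ha]
    have h2 : ((insert b s).filter (· < a)) = s.filter (· < a) := by
      rw [Finset.filter_insert, if_neg (not_lt.mpr hab.le)]
    rw [h1, h2]
    ring
  refine Finset.sum_involution (fun p _ => ⟨p.2, p.1⟩) ?_ ?_ ?_ ?_
  · rintro ⟨a, b⟩ hp
    simp only [Finset.mem_sigma, Finset.mem_compl, Finset.mem_insert, not_or] at hp
    obtain ⟨ha, hba, hb⟩ := hp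
    simp only [Finset.insert_comm b a s]
    rw [← add_smul]
    rcases lt_or_gt_of_ne hba with h | h
    · rw [add_comm, key b a h hb, zero_smul]
    · rw [key a b h ha, zero_smul]
  · rintro ⟨a, b⟩ hp _ h
    simp only [Finset.mem_sigma, Finset.mem_compl, Finset.mem_insert, not_or] at hp
    simp only [Sigma.mk.injEq] at h
    exact hp.2.1 h.1
  · rintro ⟨a, b⟩ hp
    simp only [Finset.mem_sigma, Finset.mem_compl, Finset.mem_insert, not_or] at hp ⊢
    exact ⟨hp.2.2, fun h => hp.2.1 h.symm, hp.1⟩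
  · rintro ⟨a, b⟩ _
    rfl

variable [Module k M] [IsScalarTower k (MvPolynomial (Fin d) k) M]

/-- The part of homological degree `i` and internal degree `j` of the Koszul complex of the graded
module `M = ⨁ ℳ n`: as `e_s` has degree `|s|`, the coefficients at `|s| = i` lie in `M_{j-i}`. -/
def koszulPiece (ℳ : ℕ → Submodule k M) (i j : ℕ) : Submodule k (Finset (Fin d) → M) :=
  Submodule.pi Set.univ fun s => if s.card = i ∧ i ≤ j then ℳ (j - i) else ⊥

/-- Cycles of homological degree `i` and internal degree `j`. -/
noncomputable def koszulCycles (ℳ : ℕ → Submodule k M) (i j : ℕ) :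
    Submodule k (Finset (Fin d) → M) :=
  koszulPiece ℳ i j ⊓ LinearMap.ker ((koszulD (k := k) (d := d) (M := M)).restrictScalars k)

/-- Boundaries of homological degree `i` and internal degree `j`. -/
noncomputable def koszulBoundaries (ℳ : ℕ → Submodule k M) (i j : ℕ) :
    Submodule k (Finset (Fin d) → M) :=
  (koszulPiece ℳ (i + 1) j).map ((koszulD (k := k) (d := d) (M := M)).restrictScalars k)

/-- `Tor_i^R(M, k)_j` for `R = k[x_1, …, x_d]` and a graded `R`-module `M = ⨁ ℳ n`, computed from
the Koszul complex, which is the minimal graded free resolution of `k` over `R`. -/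
abbrev GradedTor (ℳ : ℕ → Submodule k M) (i j : ℕ) : Type _ :=
  koszulCycles (d := d) ℳ i j ⧸
    (koszulBoundaries (d := d) ℳ i j).submoduleOf (koszulCycles (d := d) ℳ i j)

variable (d) in
/-- The Castelnuovo–Mumford regularity `max {j - i | Tor_i^R(M, k)_j ≠ 0}` of a graded module
`M = ⨁ ℳ n` over `R = k[x_1, …, x_d]`, with the value `-∞` for the zero module. -/
noncomputable def reg (ℳ : ℕ → Submodule k M) : EReal :=
  sSup {r : EReal | ∃ i j : ℕ, Nontrivial (GradedTor (d := d) ℳ i j) ∧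
    r = (((j : ℝ) - (i : ℝ) : ℝ) : EReal)}

end Koszul

section Gradings

variable {k : Type*} [Field k] {d : ℕ}

/-- The grading that a submodule `N` of a graded module `M = ⨁ ℳ n` inherits:
`N_n = N ∩ M_n`. -/
noncomputable def subGrading {M : Type*} [AddCommGroup M] [Module (MvPolynomial (Fin d) k) M] [Module k M]
    [IsScalarTower k (MvPolynomial (Fin d) k) M] (ℳ : ℕ → Submodule k M)
    (N : Submodule (MvPolynomial (Fin d) k) M) (n : ℕ) : Submodule k N :=
  (ℳ n).comap (N.subtype.restrictScalars k)

/-- The standard grading of `R / J`: the image of the forms of degree `n`. -/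
noncomputable def quotGrading (J : Ideal (MvPolynomial (Fin d) k)) (n : ℕ) :
    Submodule k (MvPolynomial (Fin d) k ⧸ J) :=
  (homogeneousSubmodule (Fin d) k n).map (Ideal.Quotient.mkₐ k J).toLinearMap

/-- The regularity `reg(J)` of a homogeneous ideal `J`, as a graded `R`-module. -/
noncomputable def regIdeal (J : Ideal (MvPolynomial (Fin d) k)) : EReal :=
  reg d (subGrading (homogeneousSubmodule (Fin d) k) J)

end Gradings

section Sections

variable {k : Type*} [Field k] {d : ℕ}

/-- The linear forms `ℓ_i = ∑_j g_{ij} x_j` attached to `γ = (g_{ij}) ∈ GL_d(k)`. Indices are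
shifted by one: `linForm γ i` for `i : Fin d` is the form `ℓ_{i+1}`. -/
noncomputable def linForm (γ : Matrix.GeneralLinearGroup (Fin d) k) (i : Fin d) :
    MvPolynomial (Fin d) k :=
  ∑ j, C ((γ : Matrix (Fin d) (Fin d) k) i j) * X j

/-- The ideal `I + (ℓ_{t+1}, …, ℓ_d)`, for `0 ≤ t ≤ d`. -/
noncomputable def sectionIdeal (I : Ideal (MvPolynomial (Fin d) k)) (ℓ : Fin d → MvPolynomial (Fin d) k)
    (t : ℕ) : Ideal (MvPolynomial (Fin d) k) :=
  I ⊔ Ideal.span (ℓ '' {j : Fin d | t ≤ (j : ℕ)})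

/-- The module `0 :_{M^{(t)}} ℓ_t` for `M^{(t)} = R / (I + (ℓ_{t+1}, …, ℓ_d))` and `t = j + 1`,
as a submodule of `M^{(t)}`. -/
noncomputable abbrev annModule (I : Ideal (MvPolynomial (Fin d) k)) (ℓ : Fin d → MvPolynomial (Fin d) k)
    (j : Fin d) : Submodule (MvPolynomial (Fin d) k)
      (MvPolynomial (Fin d) k ⧸ sectionIdeal I ℓ ((j : ℕ) + 1)) :=
  Submodule.torsionBy (MvPolynomial (Fin d) k)
    (MvPolynomial (Fin d) k ⧸ sectionIdeal I ℓ ((j : ℕ) + 1)) (ℓ j)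

/-- The grading of `0 :_{M^{(t)}} ℓ_t`, `t = j + 1`, as a submodule of `M^{(t)}`. -/
noncomputable def annGrading (I : Ideal (MvPolynomial (Fin d) k)) (ℓ : Fin d → MvPolynomial (Fin d) k)
    (j : Fin d) : ℕ → Submodule k (annModule I ℓ j) :=
  subGrading (quotGrading (sectionIdeal I ℓ ((j : ℕ) + 1))) (annModule I ℓ j)

/-- The sequence `ℓ_d, …, ℓ_1` (in this order) is almost regular on `R / I`: for every `t`, the
module `0 :_{M^{(t)}} ℓ_t`, where `M^{(t)} = R / (I + (ℓ_{t+1}, …, ℓ_d))`, is a finite dimensional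
`k`-vector space. -/
def IsAlmostRegular (I : Ideal (MvPolynomial (Fin d) k))
    (ℓ : Fin d → MvPolynomial (Fin d) k) : Prop :=
  ∀ j : Fin d, Module.Finite k (annModule I ℓ j)

/-- The annihilator numbers `α_{sj}(R/I) = dim_k (0 :_{M^{(d-s)}} ℓ_{d-s})_j`, `0 ≤ s ≤ d - 1`,
with respect to `ℓ_d, …, ℓ_1`. Since `s.rev = d - 1 - s`, this is `annModule` at `t = d - s`. -/
noncomputable def annNumber (I : Ideal (MvPolynomial (Fin d) k))
    (ℓ : Fin d → MvPolynomial (Fin d) k) (s : Fin d) (j : ℕ) : ℕ :=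
  Module.finrank k (annGrading I ℓ s.rev j)

/-- Zariski open subsets of `GL_d(k)`: complements of the common zero set of a family of polynomials
in the matrix entries. -/
def IsZariskiOpen (U : Set (Matrix.GeneralLinearGroup (Fin d) k)) : Prop :=
  ∃ S : Set (MvPolynomial (Fin d × Fin d) k),
    U = {γ : Matrix.GeneralLinearGroup (Fin d) k | ∃ f ∈ S,
      eval (fun p => (γ : Matrix (Fin d) (Fin d) k) p.1 p.2) f ≠ 0}

/-- The `i`-th sectional regularity `sreg_i(I)`, `0 ≤ i ≤ d`: the common value of
`reg(I + (ℓ_{i+1}, …, ℓ_d))` for all `γ` in some nonempty Zariski open subset of `GL_d(k)`. For an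
infinite field `k` there is at most one such value, because two nonempty open sets meet. -/
noncomputable def sreg (I : Ideal (MvPolynomial (Fin d) k)) (i : ℕ) : EReal :=
  Classical.epsilon fun r : EReal =>
    ∃ U : Set (Matrix.GeneralLinearGroup (Fin d) k), IsZariskiOpen U ∧ U.Nonempty ∧
      ∀ γ ∈ U, regIdeal (sectionIdeal I (linForm γ) i) = r

end Sections

end SectReg

/-! Write J_t for `sectionIdeal I ℓ t` and number the forms from 0, as the code does. Then J_t =
J_{t+1} + (ℓ_t) and J_d = I, while J_0 is the ideal 𝔪 of the variables since I ≠ R. A defect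
(`ColonDefect`) at t in degree n is a form of degree n that is nonzero in R/J_{t+1} and killed there
by ℓ_t. Almost regularity, the nonvanishing of annihilator numbers and the regularities of the
annihilators depend only on the degrees of the defects.

Fixed coordinates: let m be the largest degree of a defect with t < i. If there are no defects in
degree n > 0 at any s < t, then Tor_h(R/J_t)_{h+n} = 0 for all h, by climbing up from R/𝔪
(`torVanish_sectionIdeal`). Hence reg J_i ≤ m + 1. Conversely, a defect of degree m is a socle
element of R/J_{t+1}, so Tor_d(R/J_{t+1})_{d+m} ≠ 0, and this nonvanishing moves up to J_i
(`regIdeal_sectionIdeal_eq`). A defect at t = 0 always exists, since otherwise I = 0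
(`exists_colonDefect_zero`); so m exists for every i ≥ 1. As m is a maximum over a set of t that
grows with i, monotonicity follows. In place of long exact sequences, explicit Koszul chains and the
homotopy `koszulD_wedge` are used.

Generic coordinates: over an infinite field some γ₀ is almost regular (`exists_isAlmostRegular`).
Defects can be read off the Hilbert functions of the J_t (`not_colonDefect_iff`). These are lower
semicontinuous in γ (`exists_polynomial_hilb_le`), so in a bounded range of degrees they are all
maximal on one nonempty open set U. A telescoping sum shows that γ in U has no defect in a degree
where γ₀ has none (`not_colonDefect_of_hilb_le`), and Bayer–Stillman persistence
(`mem_of_mul_mem_succ`) excludes all higher degrees. Finitely many conditions thus fix all the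
defects, and they are the same throughout U. -/

namespace SectReg

/-! ### Homogeneous components of polynomials and of homogeneous ideals -/

section Components

variable {k : Type*} [Field k] {d : ℕ}

theorem coe_decompose_eq (p : MvPolynomial (Fin d) k) (n : ℕ) :
    (DirectSum.decompose (homogeneousSubmodule (Fin d) k) p n : MvPolynomial (Fin d) k) =
      homogeneousComponent n p :=
  decomposition.decompose'_apply p n

theorem homogeneousComponent_mul_add {a p : MvPolynomial (Fin d) k} {m : ℕ}
    (ha : a.IsHomogeneous m) (n : ℕ) :
    homogeneousComponent (m + n) (a * p) = a * homogeneousComponent n p := by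
  have h := DirectSum.coe_decompose_mul_add_of_left_mem
    (homogeneousSubmodule (Fin d) k) (j := n) (b := p) ha
  simpa only [coe_decompose_eq] using h

theorem homogeneousComponent_mul_of_lt {a p : MvPolynomial (Fin d) k} {m n : ℕ}
    (ha : a.IsHomogeneous m) (hn : n < m) :
    homogeneousComponent n (a * p) = 0 := by
  have h := DirectSum.coe_decompose_mul_of_left_mem_of_not_le
    (homogeneousSubmodule (Fin d) k) (n := n) (b := p) ha (not_le.mpr hn)
  simpa only [coe_decompose_eq] using h

theorem homogeneousComponent_of_isHomogeneous {p : MvPolynomial (Fin d) k} {n : ℕ}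
    (hp : p.IsHomogeneous n) : homogeneousComponent n p = p := by
  rw [homogeneousComponent_of_mem hp, if_pos rfl]

theorem component_mem {J : Ideal (MvPolynomial (Fin d) k)}
    (hJ : J.IsHomogeneous (homogeneousSubmodule (Fin d) k)) {p : MvPolynomial (Fin d) k}
    (hp : p ∈ J) (n : ℕ) : homogeneousComponent n p ∈ J :=
  (mem_iff_homogeneousComponent_mem hJ p).mp hp n

theorem isHomogeneous_of_component_mem {J : Ideal (MvPolynomial (Fin d) k)}
    (h : ∀ p ∈ J, ∀ n, homogeneousComponent n p ∈ J) :
    J.IsHomogeneous (homogeneousSubmodule (Fin d) k) := by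
  intro i p hp
  have := h p hp i
  simpa only [coe_decompose_eq] using this

/-- The linear form with prescribed coefficients. -/
noncomputable def linearForm (c : Fin d → k) : MvPolynomial (Fin d) k := ∑ j, C (c j) * X j

theorem isHomogeneous_linearForm (c : Fin d → k) : (linearForm c).IsHomogeneous 1 :=
  IsHomogeneous.sum _ _ _ fun j _ => isHomogeneous_C_mul_X _ j

/-- A form of positive degree is a combination of the variables. -/
theorem mem_idealOfVars_of_isHomogeneous {p : MvPolynomial (Fin d) k} {n : ℕ}
    (hp : p.IsHomogeneous (n + 1)) : p ∈ idealOfVars (Fin d) k := by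
  rw [← pow_one (idealOfVars (Fin d) k), mem_pow_idealOfVars_iff]
  intro x hx
  have := hp.degree_eq_sum_deg_support hx
  rw [Finsupp.degree_apply]
  omega

theorem mem_of_mem_sup_span_singleton {J : Ideal (MvPolynomial (Fin d) k)}
    (hJ : J.IsHomogeneous (homogeneousSubmodule (Fin d) k)) {ℓ p : MvPolynomial (Fin d) k}
    (hℓ : ℓ.IsHomogeneous 1) (hp : p ∈ J ⊔ Ideal.span {ℓ}) (hp0 : p.IsHomogeneous 0) : p ∈ J := by
  obtain ⟨q, hq, r, hr, rfl⟩ := Submodule.mem_sup.mp hp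
  obtain ⟨r, rfl⟩ := Ideal.mem_span_singleton'.mp hr
  rw [← homogeneousComponent_of_isHomogeneous hp0, map_add, mul_comm r ℓ,
    homogeneousComponent_mul_of_lt hℓ one_pos, add_zero]
  exact component_mem hJ hq 0

theorem exists_sub_mul_mem {J : Ideal (MvPolynomial (Fin d) k)}
    (hJ : J.IsHomogeneous (homogeneousSubmodule (Fin d) k)) {ℓ p : MvPolynomial (Fin d) k}
    (hℓ : ℓ.IsHomogeneous 1) (hp : p ∈ J ⊔ Ideal.span {ℓ}) {n : ℕ}
    (hpn : p.IsHomogeneous (n + 1)) : ∃ u : MvPolynomial (Fin d) k, u.IsHomogeneous n ∧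
      p - ℓ * u ∈ J := by
  obtain ⟨q, hq, r, hr, rfl⟩ := Submodule.mem_sup.mp hp
  obtain ⟨r, rfl⟩ := Ideal.mem_span_singleton'.mp hr
  refine ⟨homogeneousComponent n r, homogeneousComponent_isHomogeneous n r, ?_⟩
  rw [← homogeneousComponent_of_isHomogeneous hpn, ← homogeneousComponent_mul_add hℓ, map_add,
    mul_comm r ℓ, add_comm n 1, add_sub_cancel_right]
  exact component_mem hJ hq _

end Components

/-! ### Exterior multiplication on Koszul chains -/

section Wedge

variable {k : Type*} [Field k] {d : ℕ}
variable {M : Type*} [AddCommGroup M] [Module (MvPolynomial (Fin d) k) M]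

theorem koszulD_apply (z : Finset (Fin d) → M) (s : Finset (Fin d)) :
    koszulD (k := k) z s = ∑ a ∈ sᶜ,
      ((-1 : MvPolynomial (Fin d) k) ^ (s.filter (· < a)).card * X a) • z (insert a s) := rfl

/-- The map `e_s ↦ e_b ∧ e_s` on Koszul chains. -/
noncomputable def wedgeVar (b : Fin d) (z : Finset (Fin d) → MvPolynomial (Fin d) k) :
    Finset (Fin d) → MvPolynomial (Fin d) k :=
  fun s => if b ∈ s then (-1) ^ (s.filter (· < b)).card * z (s.erase b) else 0

/-- The sign rule for exchanging two factors of an exterior product. It serves both the homotopy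
formula `koszulD_wedgeVar` and the anticommutativity `wedgeVar_comm`. -/
theorem sign_swap {a b : Fin d} {s : Finset (Fin d)} (ha : a ∉ s) (hb : b ∈ s) :
    (-1 : MvPolynomial (Fin d) k) ^ (s.filter (· < a)).card *
        (-1) ^ ((insert a s).filter (· < b)).card =
      - ((-1) ^ (s.filter (· < b)).card * (-1) ^ ((s.erase b).filter (· < a)).card) := by
  have hab : a ≠ b := fun h => ha (h ▸ hb)
  rcases lt_or_gt_of_ne hab with h | h
  · have h1 : ((insert a s).filter (· < b)).card = (s.filter (· < b)).card + 1 := by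
      rw [Finset.filter_insert, if_pos h, Finset.card_insert_of_notMem (by simp [ha])]
    have h2 : (s.erase b).filter (· < a) = s.filter (· < a) := by
      rw [Finset.filter_erase, Finset.erase_eq_of_notMem (by simp [h.le])]
    rw [h1, h2]; ring
  · have h1 : ((insert a s).filter (· < b)) = s.filter (· < b) := by
      rw [Finset.filter_insert, if_neg (not_lt.mpr h.le)]
    have h2 : (s.filter (· < a)).card = ((s.erase b).filter (· < a)).card + 1 := by
      rw [Finset.filter_erase, Finset.card_erase_add_one (by simp [h, hb])]
    rw [h1, h2]; ring

theorem koszulD_wedgeVar (b : Fin d) (z : Finset (Fin d) → MvPolynomial (Fin d) k)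
    (s : Finset (Fin d)) :
    koszulD (k := k) (wedgeVar b z) s + wedgeVar b (koszulD (k := k) z) s = X b * z s := by
  have hsq : ∀ n : ℕ, (-1 : MvPolynomial (Fin d) k) ^ n * (-1) ^ n = 1 := fun n => by
    rw [← mul_pow]; simp
  by_cases hb : b ∈ s
  · rw [wedgeVar, if_pos hb, koszulD_apply, koszulD_apply, Finset.compl_erase,
      Finset.sum_insert (by simpa using hb), Finset.insert_erase hb, Finset.filter_erase,
      Finset.erase_eq_of_notMem (by simp), mul_add, ← add_assoc, add_right_comm]
    rw [Finset.mul_sum, ← Finset.sum_add_distrib, Finset.sum_eq_zero, zero_add,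
      smul_eq_mul, ← mul_assoc, ← mul_assoc, hsq, one_mul]
    intro a ha
    rw [Finset.mem_compl] at ha
    have hab : a ≠ b := fun h => ha (h ▸ hb)
    rw [wedgeVar, if_pos (Finset.mem_insert_of_mem hb), smul_eq_mul, smul_eq_mul,
      Finset.erase_insert_of_ne hab]
    have := sign_swap (k := k) ha hb
    linear_combination (X a * z (insert a (s.erase b))) * this
  · rw [wedgeVar, if_neg hb, koszulD_apply, add_zero,
      Finset.sum_eq_single_of_mem b (by simpa using hb)]
    · rw [wedgeVar, if_pos (Finset.mem_insert_self b s), Finset.erase_insert hb,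
        Finset.filter_insert, if_neg (lt_irrefl b), smul_eq_mul]
      linear_combination (X b * z s) * hsq (s.filter (· < b)).card
    · intro a _ hab
      rw [wedgeVar, if_neg (by simp [hab.symm, hb]), smul_zero]

theorem wedgeVar_wedgeVar_self (b : Fin d) (z : Finset (Fin d) → MvPolynomial (Fin d) k) :
    wedgeVar b (wedgeVar b z) = 0 := by
  funext s
  simp [wedgeVar]

theorem wedgeVar_comm (a b : Fin d) (hab : a ≠ b) (z : Finset (Fin d) → MvPolynomial (Fin d) k) :
    wedgeVar a (wedgeVar b z) = - wedgeVar b (wedgeVar a z) := by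
  funext s
  by_cases ha : a ∈ s <;> by_cases hb : b ∈ s
  · have h := sign_swap (k := k) (s := s.erase a) (Finset.notMem_erase a s)
      (Finset.mem_erase.mpr ⟨hab.symm, hb⟩)
    have hf : (s.erase a).filter (· < a) = s.filter (· < a) := by
      rw [Finset.filter_erase, Finset.erase_eq_of_notMem (by simp)]
    have hg : (s.erase b).filter (· < b) = s.filter (· < b) := by
      rw [Finset.filter_erase, Finset.erase_eq_of_notMem (by simp)]
    have hf' : ((s.erase a).erase b).filter (· < a) = (s.erase b).filter (· < a) := by
      rw [Finset.erase_right_comm, Finset.filter_erase, Finset.erase_eq_of_notMem (by simp)]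
    rw [Finset.insert_erase ha, hf, hf'] at h
    have hsq : ∀ n : ℕ, (-1 : MvPolynomial (Fin d) k) ^ n * (-1) ^ n = 1 := fun n => by
      rw [← mul_pow]; simp
    simp only [wedgeVar, Pi.neg_apply, ha, hb, if_true, Finset.mem_erase, ne_eq, hab, hab.symm,
      not_false_eq_true, true_and, Finset.erase_right_comm (a := b) (b := a)]
    generalize (-1 : MvPolynomial (Fin d) k) ^ (s.filter (· < a)).card = A at *
    have h1 := hsq (s.filter (· < b)).card
    have h2 := hsq ((s.erase a).filter (· < b)).card
    linear_combination (z ((s.erase a).erase b) *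
      (-1) ^ (s.filter (· < b)).card * (-1) ^ ((s.erase a).filter (· < b)).card) * h
      - (A * (-1) ^ ((s.erase a).filter (· < b)).card * z ((s.erase a).erase b)) * h1
      - ((-1) ^ (s.filter (· < b)).card * (-1) ^ ((s.erase b).filter (· < a)).card *
        z ((s.erase a).erase b)) * h2
  all_goals simp [wedgeVar, ha, hb]

/-- The map `e_s ↦ (∑ c_b e_b) ∧ e_s` on Koszul chains. -/
noncomputable def wedge (c : Fin d → k) (z : Finset (Fin d) → MvPolynomial (Fin d) k) :
    Finset (Fin d) → MvPolynomial (Fin d) k :=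
  ∑ b, (C (c b) : MvPolynomial (Fin d) k) • wedgeVar b z

theorem wedge_apply (c : Fin d → k) (z : Finset (Fin d) → MvPolynomial (Fin d) k)
    (s : Finset (Fin d)) : wedge c z s = ∑ b, C (c b) * wedgeVar b z s := by
  simp [wedge, Finset.sum_apply]

/-- Wedging with e = ∑ c_b e_b is a homotopy between 0 and multiplication by the form ℓ = ∑ c_b x_b.
Every comparison of R/J with R/(J + (ℓ)) rests on it. -/
theorem koszulD_wedge (c : Fin d → k) (z : Finset (Fin d) → MvPolynomial (Fin d) k)
    (s : Finset (Fin d)) :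
    koszulD (k := k) (wedge c z) s + wedge c (koszulD (k := k) z) s = linearForm c * z s := by
  rw [wedge_apply, wedge, map_sum, Finset.sum_apply, ← Finset.sum_add_distrib, linearForm,
    Finset.sum_mul]
  refine Finset.sum_congr rfl fun b _ => ?_
  rw [map_smul, Pi.smul_apply, smul_eq_mul, ← mul_add, koszulD_wedgeVar, mul_assoc]

theorem wedgeVar_smul_sum {ι : Type*} (S : Finset ι) (b : Fin d) (r : ι → MvPolynomial (Fin d) k)
    (z : ι → Finset (Fin d) → MvPolynomial (Fin d) k) :
    wedgeVar b (∑ i ∈ S, r i • z i) = ∑ i ∈ S, r i • wedgeVar b (z i) := by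
  funext s
  simp only [wedgeVar, Finset.sum_apply, Pi.smul_apply, smul_eq_mul]
  split_ifs
  · rw [Finset.mul_sum]
    exact Finset.sum_congr rfl fun i _ => by ring
  · simp

theorem wedge_wedge (c : Fin d → k) (z : Finset (Fin d) → MvPolynomial (Fin d) k) :
    wedge c (wedge c z) = 0 := by
  simp only [wedge, wedgeVar_smul_sum, Finset.smul_sum, smul_smul]
  rw [← Finset.sum_product', Finset.univ_product_univ]
  refine Finset.sum_involution (fun p _ => p.swap) ?_ ?_ ?_ ?_
  · rintro ⟨a, b⟩ _
    simp only [Prod.swap_prod_mk]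
    by_cases hab : a = b
    · subst hab; simp [wedgeVar_wedgeVar_self]
    · rw [wedgeVar_comm a b hab, mul_comm]; simp
  · rintro ⟨a, b⟩ _ h h'
    obtain rfl : b = a := congrArg Prod.fst h'
    exact h (by rw [wedgeVar_wedgeVar_self, smul_zero])
  · intros; simp
  · intros; simp

theorem wedge_mem {J : Ideal (MvPolynomial (Fin d) k)} (c : Fin d → k)
    {z : Finset (Fin d) → MvPolynomial (Fin d) k} (hz : ∀ s, z s ∈ J) (s : Finset (Fin d)) :
    wedge c z s ∈ J := by
  rw [wedge_apply]
  refine Ideal.sum_mem _ fun b _ => Ideal.mul_mem_left _ _ ?_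
  rw [wedgeVar]
  split_ifs
  · exact Ideal.mul_mem_left _ _ (hz _)
  · exact zero_mem _

theorem koszulD_mem {J : Ideal (MvPolynomial (Fin d) k)}
    {z : Finset (Fin d) → MvPolynomial (Fin d) k} (hz : ∀ s, z s ∈ J) (s : Finset (Fin d)) :
    koszulD (k := k) z s ∈ J := by
  rw [koszulD_apply]
  exact Ideal.sum_mem _ fun a _ => Ideal.mul_mem_left _ _ (hz _)

end Wedge

/-! ### Vanishing of Koszul homology along a linear form -/

section Chains

variable {k : Type*} [Field k] {d : ℕ}

theorem mem_koszulPiece {M : Type*} [AddCommGroup M] [Module (MvPolynomial (Fin d) k) M]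
    [Module k M] [IsScalarTower k (MvPolynomial (Fin d) k) M] {ℳ : ℕ → Submodule k M} {i j : ℕ}
    {z : Finset (Fin d) → M} :
    z ∈ koszulPiece ℳ i j ↔
      (∀ s : Finset (Fin d), s.card = i → i ≤ j → z s ∈ ℳ (j - i)) ∧
        ∀ s : Finset (Fin d), ¬ (s.card = i ∧ i ≤ j) → z s = 0 := by
  rw [koszulPiece, Submodule.mem_pi]
  constructor
  · intro h
    refine ⟨fun s h1 h2 => ?_, fun s hs => ?_⟩
    · simpa [h1, h2] using h s trivial
    · simpa [hs] using h s trivial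
  · rintro ⟨h1, h2⟩ s _
    split_ifs with hs
    · exact h1 s hs.1 hs.2
    · simpa using h2 s hs

variable (k d) in
/-- The forms of given degrees in the Koszul complex of the polynomial ring. -/
noncomputable abbrev formChains (i j : ℕ) :
    Submodule k (Finset (Fin d) → MvPolynomial (Fin d) k) :=
  koszulPiece (homogeneousSubmodule (Fin d) k) i j

/-- With the internal degree written as i + n, the number n is the degree of the coefficients and
also the contribution j - i to the regularity. Later statements are indexed this way. -/
theorem mem_formChains {i n : ℕ} {z : Finset (Fin d) → MvPolynomial (Fin d) k} :
    z ∈ formChains k d i (i + n) ↔ (∀ s, (z s).IsHomogeneous n) ∧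
      ∀ s : Finset (Fin d), s.card ≠ i → z s = 0 := by
  rw [mem_koszulPiece]
  simp only [le_add_iff_nonneg_right, zero_le, and_true, forall_const, add_tsub_cancel_left,
    mem_homogeneousSubmodule]
  refine ⟨fun ⟨h1, h2⟩ => ⟨fun s => ?_, h2⟩, fun ⟨h1, h2⟩ => ⟨fun s _ => h1 s, h2⟩⟩
  by_cases hs : s.card = i
  · exact h1 s hs
  · rw [h2 s hs]; exact isHomogeneous_zero _ _ _

theorem formChains_eq_zero {i j : ℕ} (hij : j < i) {z : Finset (Fin d) → MvPolynomial (Fin d) k}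
    (hz : z ∈ formChains k d i j) : z = 0 := by
  funext s
  exact (mem_koszulPiece.mp hz).2 s fun h => absurd h.2 (by omega)

theorem formChains_eq_zero_of_card {i j : ℕ} (hi : d < i)
    {z : Finset (Fin d) → MvPolynomial (Fin d) k} (hz : z ∈ formChains k d i j) : z = 0 := by
  funext s
  refine (mem_koszulPiece.mp hz).2 s fun h => ?_
  have := s.card_le_univ
  rw [Fintype.card_fin] at this
  omega

theorem isHomogeneous_koszulD {z : Finset (Fin d) → MvPolynomial (Fin d) k} {n : ℕ}
    (hz : ∀ s, (z s).IsHomogeneous n) (s : Finset (Fin d)) :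
    (koszulD (k := k) z s).IsHomogeneous (n + 1) := by
  rw [koszulD_apply]
  refine IsHomogeneous.sum _ _ _ fun a _ => ?_
  rw [smul_eq_mul, add_comm]
  refine IsHomogeneous.mul ?_ (hz _)
  rcases neg_one_pow_eq_or (MvPolynomial (Fin d) k) (s.filter (· < a)).card with h | h
  · rw [h, one_mul]; exact isHomogeneous_X _ _
  · rw [h, neg_one_mul]; exact (isHomogeneous_X _ _).neg

theorem koszulD_mem_formChains {i n : ℕ} {z : Finset (Fin d) → MvPolynomial (Fin d) k}
    (hz : z ∈ formChains k d (i + 1) (i + 1 + n)) :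
    koszulD (k := k) z ∈ formChains k d i (i + (n + 1)) := by
  obtain ⟨h1, h2⟩ := mem_formChains.mp hz
  refine mem_formChains.mpr ⟨isHomogeneous_koszulD h1, fun s hs => ?_⟩
  rw [koszulD_apply]
  refine Finset.sum_eq_zero fun a ha => ?_
  rw [h2, smul_zero]
  rw [Finset.card_insert_of_notMem (Finset.mem_compl.mp ha)]
  omega

theorem koszulD_mem_formChains' {i j : ℕ} {z : Finset (Fin d) → MvPolynomial (Fin d) k}
    (hz : z ∈ formChains k d (i + 1) j) : koszulD (k := k) z ∈ formChains k d i j := by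
  rcases lt_or_ge j (i + 1) with h | h
  · rw [formChains_eq_zero h hz, map_zero]; exact zero_mem _
  · obtain ⟨n, rfl⟩ := Nat.exists_eq_add_of_le h
    have := koszulD_mem_formChains hz
    rwa [show i + (n + 1) = i + 1 + n by ring] at this

theorem koszulD_eq_zero_of_mem_formChains_zero {j : ℕ}
    {z : Finset (Fin d) → MvPolynomial (Fin d) k}
    (hz : z ∈ formChains k d 0 j) : koszulD (k := k) z = 0 := by
  funext s
  rw [koszulD_apply]
  refine Finset.sum_eq_zero fun a ha => ?_
  rw [(mem_koszulPiece.mp hz).2, smul_zero]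
  simp

theorem wedge_mem_formChains (c : Fin d → k) {i n : ℕ}
    {z : Finset (Fin d) → MvPolynomial (Fin d) k} (hz : z ∈ formChains k d i (i + n)) :
    wedge c z ∈ formChains k d (i + 1) (i + 1 + n) := by
  obtain ⟨h1, h2⟩ := mem_formChains.mp hz
  refine mem_formChains.mpr ⟨fun s => ?_, fun s hs => ?_⟩
  · rw [wedge_apply]
    refine IsHomogeneous.sum _ _ _ fun b _ => ?_
    refine IsHomogeneous.C_mul ?_ _
    rw [wedgeVar]
    split_ifs
    · rcases neg_one_pow_eq_or (MvPolynomial (Fin d) k) (s.filter (· < b)).card with h | h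
      · rw [h, one_mul]; exact h1 _
      · rw [h, neg_one_mul]; exact (h1 _).neg
    · exact isHomogeneous_zero _ _ _
  · rw [wedge_apply]
    refine Finset.sum_eq_zero fun b _ => ?_
    rw [wedgeVar]
    split_ifs with hb
    · rw [h2, mul_zero, mul_zero]
      have := Finset.card_erase_add_one hb
      omega
    · rw [mul_zero]

/-- A chain with coefficients in `J + (ℓ)` is a multiple of `ℓ` modulo `J`. -/
theorem exists_chain_sub_mul_mem {J : Ideal (MvPolynomial (Fin d) k)}
    (hJ : J.IsHomogeneous (homogeneousSubmodule (Fin d) k)) {ℓ : MvPolynomial (Fin d) k}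
    (hℓ : ℓ.IsHomogeneous 1) {i j : ℕ} {z : Finset (Fin d) → MvPolynomial (Fin d) k}
    (hz : z ∈ formChains k d i (j + 1)) (hzJ : ∀ s, z s ∈ J ⊔ Ideal.span {ℓ}) :
    ∃ u ∈ formChains k d i j, ∀ s, z s - ℓ * u s ∈ J := by
  obtain ⟨h1, h2⟩ := mem_koszulPiece.mp hz
  rcases lt_or_ge j i with hij | hij
  -- Here the coefficients of z are zero or constants, and J + (ℓ) contains no constants beyond
  -- those of J.
  · refine ⟨0, zero_mem _, fun s => ?_⟩
    rw [Pi.zero_apply, mul_zero, sub_zero]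
    by_cases hs : s.card = i ∧ i ≤ j + 1
    · refine mem_of_mem_sup_span_singleton hJ hℓ (hzJ s) ?_
      have := h1 s hs.1 hs.2
      rwa [show j + 1 - i = 0 by omega] at this
    · rw [h2 s hs]; exact zero_mem _
  · have key : ∀ s : Finset (Fin d), s.card = i →
        ∃ u : MvPolynomial (Fin d) k, u.IsHomogeneous (j - i) ∧ z s - ℓ * u ∈ J := by
      intro s hs
      refine exists_sub_mul_mem hJ hℓ (hzJ s) ?_
      have := h1 s hs (by omega)
      rwa [show j + 1 - i = j - i + 1 by omega] at this
    choose u hu1 hu2 using key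
    refine ⟨fun s => if h : s.card = i then u s h else 0, mem_koszulPiece.mpr ⟨?_, ?_⟩, ?_⟩
    · intro s hs _
      simpa [hs] using hu1 s hs
    · intro s hs
      have : s.card ≠ i := fun h => hs ⟨h, hij⟩
      simp [this]
    · intro s
      by_cases hs : s.card = i
      · simpa [hs] using hu2 s hs
      · simp only [hs, dite_false, mul_zero, sub_zero]
        rw [h2 s (fun h => hs h.1)]; exact zero_mem _

/-- Vanishing of `Tor_i(R / J, k)_j`, in terms of Koszul chains in `R`. -/
def TorVanish (J : Ideal (MvPolynomial (Fin d) k)) (i j : ℕ) : Prop :=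
  ∀ z ∈ formChains k d i j, (∀ s, koszulD (k := k) z s ∈ J) →
    ∃ w ∈ formChains k d (i + 1) j, ∀ s, z s - koszulD (k := k) w s ∈ J

theorem koszulD_sub_koszulD (z w : Finset (Fin d) → MvPolynomial (Fin d) k) :
    koszulD (k := k) (z - koszulD (k := k) w) = koszulD (k := k) z := by
  rw [map_sub, koszulD_koszulD, sub_zero]

/-- If `ℓ` is a nonzerodivisor on `R / J` in degree `n`, vanishing lifts from `R / (J + (ℓ))`. -/
theorem TorVanish.of_sup {J : Ideal (MvPolynomial (Fin d) k)}
    (hJ : J.IsHomogeneous (homogeneousSubmodule (Fin d) k)) (c : Fin d → k) {i n : ℕ}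
    (hcolon : ∀ p : MvPolynomial (Fin d) k, p.IsHomogeneous n → linearForm c * p ∈ J → p ∈ J)
    (h : TorVanish (J ⊔ Ideal.span {linearForm c}) (i + 1) (i + 1 + n)) :
    TorVanish J i (i + n) := by
  intro z hz hDz
  have hwz := wedge_mem_formChains c hz
  have hℓ := isHomogeneous_linearForm c
  have hℓmem : linearForm c ∈ J ⊔ Ideal.span {linearForm c} :=
    Ideal.mem_sup_right (Ideal.mem_span_singleton_self _)
  have hid := koszulD_wedge c z
  -- By the homotopy D(e ∧ z) = ℓz - e ∧ Dz, so e ∧ z is a cycle modulo J + (ℓ).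
  obtain ⟨w, hw, hw'⟩ := h (wedge c z) hwz (fun s => by
    rw [eq_sub_of_add_eq (hid s)]
    exact sub_mem (Ideal.mul_mem_right _ _ hℓmem) (Ideal.mem_sup_left (wedge_mem c hDz s)))
  have hy : wedge c z - koszulD (k := k) w ∈ formChains k d (i + 1) (i + n + 1) := by
    have := sub_mem hwz (koszulD_mem_formChains' hw)
    rwa [show i + n + 1 = i + 1 + n by ring]
  obtain ⟨u, hu, hu'⟩ := exists_chain_sub_mul_mem hJ hℓ hy hw'
  refine ⟨u, hu, fun s => ?_⟩
  have hDu := koszulD_mem_formChains' hu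
  refine hcolon _ ?_ ?_
  · exact (mem_formChains.mp (sub_mem hz hDu)).1 s
  -- Applying D to e ∧ z - Dw - ℓu, whose coefficients lie in J, gives ℓ(z - Du) ∈ J; the
  -- coefficients of z - Du have degree n, where ℓ can be cancelled.
  · have h1 : koszulD (k := k) (wedge c z - koszulD (k := k) w - linearForm c • u) s ∈ J :=
      koszulD_mem hu' s
    rw [map_sub, koszulD_sub_koszulD, map_smul, Pi.sub_apply, eq_sub_of_add_eq (hid s)] at h1
    have h2 := add_mem h1 (wedge_mem c hDz s)
    rw [Pi.smul_apply, smul_eq_mul] at h2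
    convert h2 using 1
    ring

/-- Vanishing passes from `R / J` to `R / (J + (ℓ))` if `ℓ` is a nonzerodivisor on `R / J` in
the next degree. -/
theorem TorVanish.sup {J : Ideal (MvPolynomial (Fin d) k)}
    (hJ : J.IsHomogeneous (homogeneousSubmodule (Fin d) k)) {ℓ : MvPolynomial (Fin d) k}
    (hℓ : ℓ.IsHomogeneous 1) {i n : ℕ}
    (hcolon : ∀ p : MvPolynomial (Fin d) k, p.IsHomogeneous (n + 1) → ℓ * p ∈ J → p ∈ J)
    (h0 : TorVanish J i (i + n)) (h1 : TorVanish J (i + 1) (i + 1 + n)) :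
    TorVanish (J ⊔ Ideal.span {ℓ}) (i + 1) (i + 1 + n) := by
  intro z hz hDz
  have hDz1 : koszulD (k := k) z ∈ formChains k d i (i + n + 1) := koszulD_mem_formChains hz
  obtain ⟨u, hu, hu'⟩ := exists_chain_sub_mul_mem hJ hℓ hDz1 hDz
  -- From Dz ≡ ℓu and D² = 0 one gets ℓ·Du ∈ J, in degree n + 1. So u is a cycle modulo J, and
  -- writing u ≡ Dw turns z - ℓw into one.
  have hDu : ∀ s, koszulD (k := k) u s ∈ J := by
    intro s
    refine hcolon _ (isHomogeneous_koszulD (mem_formChains.mp hu).1 s) ?_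
    have h1 : koszulD (k := k) (koszulD (k := k) z - ℓ • u) s ∈ J := koszulD_mem hu' s
    rw [map_sub, koszulD_koszulD, map_smul, zero_sub] at h1
    simpa using h1
  obtain ⟨w, hw, hw'⟩ := h0 u hu hDu
  have hlw : ℓ • w ∈ formChains k d (i + 1) (i + 1 + n) := by
    -- For n = 0 the coefficients of w would have degree -1, so w = 0.
    rcases n with _ | n
    · rw [formChains_eq_zero (by omega) hw, smul_zero]; exact zero_mem _
    · rw [show i + (n + 1) = i + 1 + n by ring] at hw
      obtain ⟨g1, g2⟩ := mem_formChains.mp hw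
      refine mem_formChains.mpr ⟨fun s => ?_, fun s hs => ?_⟩
      · rw [Pi.smul_apply, smul_eq_mul, add_comm n 1]; exact hℓ.mul (g1 s)
      · rw [Pi.smul_apply, g2 s hs, smul_zero]
  obtain ⟨v, hv, hv'⟩ := h1 (z - ℓ • w) (sub_mem hz hlw) (fun s => by
    rw [map_sub, map_smul, Pi.sub_apply, Pi.smul_apply, smul_eq_mul]
    have := add_mem (hu' s) (Ideal.mul_mem_left _ ℓ (hw' s))
    convert this using 1
    ring)
  refine ⟨v, hv, fun s => ?_⟩
  have h2 := Ideal.mem_sup_left (T := Ideal.span {ℓ}) (hv' s)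
  have h3 : ℓ * w s ∈ J ⊔ Ideal.span {ℓ} :=
    Ideal.mem_sup_right (Ideal.mul_mem_right _ _ (Ideal.mem_span_singleton_self _))
  have := add_mem h2 h3
  rw [Pi.sub_apply, Pi.smul_apply, smul_eq_mul] at this
  convert this using 1
  ring

/-- The chain p e_1 ∧ … ∧ e_d is a cycle modulo J because the variables kill p, and there are no
chains of homological degree d + 1 to bound it. -/
theorem not_torVanish_of_socle {J : Ideal (MvPolynomial (Fin d) k)} {p : MvPolynomial (Fin d) k}
    {n : ℕ} (hp : p.IsHomogeneous n) (hpJ : p ∉ J) (hX : ∀ a, X a * p ∈ J) :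
    ¬ TorVanish J d (d + n) := by
  intro h
  have hz : Pi.single Finset.univ p ∈ formChains k d d (d + n) := by
    refine mem_formChains.mpr ⟨fun s => ?_, fun s hs => ?_⟩
    · by_cases hs : s = Finset.univ
      · subst hs; rwa [Pi.single_eq_same]
      · rw [Pi.single_eq_of_ne hs]; exact isHomogeneous_zero _ _ _
    · refine Pi.single_eq_of_ne (fun h => hs ?_) _
      rw [h, Finset.card_univ, Fintype.card_fin]
  have hD : ∀ s, koszulD (k := k) (d := d) (Pi.single Finset.univ p) s ∈ J := by
    intro s
    rw [koszulD_apply]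
    refine Ideal.sum_mem _ fun a _ => ?_
    rw [smul_eq_mul, mul_assoc]
    refine Ideal.mul_mem_left _ _ ?_
    by_cases hs : insert a s = Finset.univ
    · rw [hs, Pi.single_eq_same]; exact hX a
    · rw [Pi.single_eq_of_ne hs, mul_zero]; exact zero_mem _
  obtain ⟨w, hw, hw'⟩ := h _ hz hD
  have := hw' Finset.univ
  rw [formChains_eq_zero_of_card (Nat.lt_succ_self d) hw, Pi.single_eq_same, map_zero,
    Pi.zero_apply, sub_zero] at this
  exact hpJ this

theorem torVanish_of_idealOfVars_le {J : Ideal (MvPolynomial (Fin d) k)}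
    (hJ : idealOfVars (Fin d) k ≤ J) {i n : ℕ} (h : n ≠ 0 ∨ d < i) :
    TorVanish J i (i + n) := by
  intro z hz _
  refine ⟨0, zero_mem _, fun s => ?_⟩
  rw [map_zero, Pi.zero_apply, sub_zero]
  rcases h with h | h
  · obtain ⟨n, rfl⟩ := Nat.exists_eq_succ_of_ne_zero h
    exact hJ (mem_idealOfVars_of_isHomogeneous ((mem_formChains.mp hz).1 s))
  · rw [formChains_eq_zero_of_card h hz]; exact zero_mem _

end Chains

/-! ### Section ideals, coordinate changes and exactness of the Koszul complex -/

section SectionIdeals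

variable {k : Type*} [Field k] {d : ℕ}

theorem linForm_eq (γ : Matrix.GeneralLinearGroup (Fin d) k) (i : Fin d) :
    linForm γ i = linearForm ((γ : Matrix (Fin d) (Fin d) k) i) := rfl

theorem linearForm_single (j : Fin d) : linearForm (Pi.single j (1 : k)) = X j := by
  rw [linearForm, Finset.sum_eq_single j]
  · simp
  · intro b _ hb; simp [Pi.single_eq_of_ne hb]
  · simp

theorem sectionIdeal_eq_sup (I : Ideal (MvPolynomial (Fin d) k))
    (ℓ : Fin d → MvPolynomial (Fin d) k) (t : Fin d) :
    sectionIdeal I ℓ t = sectionIdeal I ℓ (t + 1) ⊔ Ideal.span {ℓ t} := by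
  have : {j : Fin d | (t : ℕ) ≤ (j : ℕ)} = {j : Fin d | (t : ℕ) + 1 ≤ (j : ℕ)} ∪ {t} := by
    ext j
    simp only [Set.mem_ofPred_eq, Set.mem_union, Set.mem_singleton_iff, Fin.ext_iff]
    omega
  rw [sectionIdeal, sectionIdeal, this, Set.image_union, Set.image_singleton, Ideal.span_union,
    sup_assoc]

theorem sectionIdeal_of_le (I : Ideal (MvPolynomial (Fin d) k))
    (ℓ : Fin d → MvPolynomial (Fin d) k) {t : ℕ} (ht : d ≤ t) : sectionIdeal I ℓ t = I := by
  have : {j : Fin d | t ≤ (j : ℕ)} = ∅ := by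
    ext j
    simp only [Set.mem_ofPred_eq, Set.mem_empty_iff_false, iff_false]
    omega
  rw [sectionIdeal, this]
  simp

theorem mem_sectionIdeal {I : Ideal (MvPolynomial (Fin d) k)}
    {ℓ : Fin d → MvPolynomial (Fin d) k} {t : ℕ} {j : Fin d} (h : t ≤ j) :
    ℓ j ∈ sectionIdeal I ℓ t :=
  Ideal.mem_sup_right (Ideal.subset_span ⟨j, h, rfl⟩)

theorem sectionIdeal_congr {I : Ideal (MvPolynomial (Fin d) k)}
    {ℓ ℓ' : Fin d → MvPolynomial (Fin d) k} {t : ℕ} (h : ∀ j : Fin d, t ≤ j → ℓ j = ℓ' j) :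
    sectionIdeal I ℓ t = sectionIdeal I ℓ' t := by
  have : ℓ '' {j : Fin d | t ≤ (j : ℕ)} = ℓ' '' {j : Fin d | t ≤ (j : ℕ)} :=
    Set.image_congr fun j hj => h j hj
  rw [sectionIdeal, sectionIdeal, this]

theorem sectionIdeal_isHomogeneous {I : Ideal (MvPolynomial (Fin d) k)}
    (hI : I.IsHomogeneous (homogeneousSubmodule (Fin d) k)) {ℓ : Fin d → MvPolynomial (Fin d) k}
    (hℓ : ∀ j, (ℓ j).IsHomogeneous 1) (t : ℕ) :
    (sectionIdeal I ℓ t).IsHomogeneous (homogeneousSubmodule (Fin d) k) := by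
  refine hI.sup (Ideal.homogeneous_span _ _ ?_)
  rintro _ ⟨j, _, rfl⟩
  exact ⟨1, hℓ j⟩

/-- Multiplication by `ℓ_t` on `R / (I + (ℓ_{t+1}, …))` is not injective in degree `n`. -/
def ColonDefect (I : Ideal (MvPolynomial (Fin d) k)) (ℓ : Fin d → MvPolynomial (Fin d) k)
    (t : Fin d) (n : ℕ) : Prop :=
  ∃ p : MvPolynomial (Fin d) k, p.IsHomogeneous n ∧ ℓ t * p ∈ sectionIdeal I ℓ (t + 1) ∧
    p ∉ sectionIdeal I ℓ (t + 1)

theorem mem_of_not_colonDefect {I : Ideal (MvPolynomial (Fin d) k)}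
    {ℓ : Fin d → MvPolynomial (Fin d) k} {t : Fin d} {n : ℕ} (h : ¬ ColonDefect I ℓ t n)
    {p : MvPolynomial (Fin d) k} (hp : p.IsHomogeneous n)
    (hm : ℓ t * p ∈ sectionIdeal I ℓ (t + 1)) : p ∈ sectionIdeal I ℓ (t + 1) := by
  by_contra hc
  exact h ⟨p, hp, hm, hc⟩

/-- The base case is a quotient of R/𝔪. Each further step is `TorVanish.of_sup`, which lowers the
homological degree by one while t grows by one; so i + t is constant, which explains the condition
for n = 0. -/
theorem torVanish_sectionIdeal {I : Ideal (MvPolynomial (Fin d) k)}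
    (hI : I.IsHomogeneous (homogeneousSubmodule (Fin d) k)) (c : Fin d → Fin d → k)
    (h0 : idealOfVars (Fin d) k ≤ sectionIdeal I (fun j => linearForm (c j)) 0) (n : ℕ) (t : ℕ)
    (ht : t ≤ d) (hE : ∀ s : Fin d, (s : ℕ) < t → ¬ ColonDefect I (fun j => linearForm (c j)) s n)
    (i : ℕ) (hi : n ≠ 0 ∨ d < i + t) :
    TorVanish (sectionIdeal I (fun j => linearForm (c j)) t) i (i + n) := by
  induction t generalizing i with
  | zero => exact torVanish_of_idealOfVars_le h0 hi
  | succ t ih =>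
    have h := ih (by omega) (fun s hs => hE s (by omega)) (i + 1) (by omega)
    have hs := sectionIdeal_eq_sup I (fun j => linearForm (c j)) ⟨t, ht⟩
    simp only at hs
    rw [hs] at h
    refine TorVanish.of_sup (sectionIdeal_isHomogeneous hI (fun j => isHomogeneous_linearForm _) _)
      _ (fun p hp hm => ?_) h
    exact mem_of_not_colonDefect (hE ⟨t, ht⟩ (Nat.lt_succ_self t)) hp hm

/-- The substitution of the linear forms attached to a matrix. -/
noncomputable def substHom (A : Matrix (Fin d) (Fin d) k) :
    MvPolynomial (Fin d) k →ₐ[k] MvPolynomial (Fin d) k :=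
  aeval fun i => linearForm (A i)

theorem substHom_linearForm (A B : Matrix (Fin d) (Fin d) k) (i : Fin d) :
    substHom A (linearForm (B i)) = linearForm ((B * A) i) := by
  simp only [linearForm, substHom, map_sum, map_mul, aeval_X, algHom_C, algebraMap_eq,
    Matrix.mul_apply, Finset.mul_sum, Finset.sum_mul]
  rw [Finset.sum_comm]
  refine Finset.sum_congr rfl fun j _ => Finset.sum_congr rfl fun l _ => by ring

theorem substHom_comp (A B : Matrix (Fin d) (Fin d) k) (h : B * A = 1)
    (p : MvPolynomial (Fin d) k) : substHom A (substHom B p) = p := by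
  have : (substHom A).comp (substHom B) = AlgHom.id k _ := by
    refine algHom_ext fun i => ?_
    rw [AlgHom.comp_apply, substHom, substHom, aeval_X]
    change substHom A _ = _
    rw [substHom_linearForm, h, AlgHom.id_apply, ← linearForm_single]
    congr 1
    funext j
    rw [Matrix.one_apply, Pi.single_apply]
    simp [eq_comm]
  exact DFunLike.congr_fun this p

/-- Setting the variables `x_j` with `t ≤ j` to zero. -/
noncomputable def truncHom (k : Type*) [Field k] (d t : ℕ) :
    MvPolynomial (Fin d) k →ₐ[k] MvPolynomial (Fin d) k :=
  aeval fun i : Fin d => if t ≤ (i : ℕ) then 0 else X i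

theorem ker_truncHom (t : ℕ) {p : MvPolynomial (Fin d) k} (hp : truncHom k d t p = 0) :
    p ∈ Ideal.span ((X : Fin d → MvPolynomial (Fin d) k) '' {j : Fin d | t ≤ (j : ℕ)}) := by
  set S := Ideal.span ((X : Fin d → MvPolynomial (Fin d) k) '' {j : Fin d | t ≤ (j : ℕ)})
  have : (Ideal.Quotient.mkₐ k S).comp (truncHom k d t) = Ideal.Quotient.mkₐ k S := by
    refine algHom_ext fun i => ?_
    rw [AlgHom.comp_apply, truncHom, aeval_X]
    split_ifs with h
    · rw [map_zero, eq_comm]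
      exact Ideal.Quotient.eq_zero_iff_mem.mpr (Ideal.subset_span ⟨i, h, rfl⟩)
    · rfl
  have h := DFunLike.congr_fun this p
  rw [AlgHom.comp_apply, hp, map_zero, eq_comm] at h
  exact Ideal.Quotient.eq_zero_iff_mem.mp h

variable (γ : Matrix.GeneralLinearGroup (Fin d) k)

/-- The homomorphism with kernel generated by the linear forms `ℓ_j`, `t ≤ j`. -/
noncomputable def sectionHom (t : ℕ) : MvPolynomial (Fin d) k →ₐ[k] MvPolynomial (Fin d) k :=
  (truncHom k d t).comp (substHom ((γ⁻¹ : Matrix.GeneralLinearGroup (Fin d) k) :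
    Matrix (Fin d) (Fin d) k))

theorem sectionHom_linForm (t : ℕ) (i : Fin d) :
    sectionHom γ t (linForm γ i) = if t ≤ (i : ℕ) then 0 else X i := by
  rw [sectionHom, AlgHom.comp_apply, linForm_eq, substHom_linearForm, ← Units.val_mul,
    mul_inv_cancel, Units.val_one]
  have : linearForm ((1 : Matrix (Fin d) (Fin d) k) i) = X i := by
    rw [← linearForm_single]
    congr 1
    funext j
    rw [Matrix.one_apply, Pi.single_apply]
    simp [eq_comm]
  rw [this, truncHom, aeval_X]

theorem ker_sectionHom (t : ℕ) :
    RingHom.ker (sectionHom γ t) = sectionIdeal ⊥ (linForm γ) t := by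
  refine le_antisymm (fun p hp => ?_) ?_
  · have h1 := ker_truncHom t (p := substHom ((γ⁻¹ : Matrix.GeneralLinearGroup (Fin d) k) :
      Matrix (Fin d) (Fin d) k) p) hp
    -- Substituting back with γ turns the variables x_j into the forms ℓ_j.
    have h2 := Ideal.mem_map_of_mem (substHom (γ : Matrix (Fin d) (Fin d) k)) h1
    rw [substHom_comp _ _ (by rw [← Units.val_mul, inv_mul_cancel, Units.val_one]),
      Ideal.map_span] at h2
    refine Ideal.mem_sup_right (Ideal.span_mono ?_ h2)
    rintro _ ⟨_, ⟨j, hj, rfl⟩, rfl⟩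
    refine ⟨j, hj, ?_⟩
    rw [substHom, aeval_X]
    rfl
  · rw [sectionIdeal, bot_sup_eq, Ideal.span_le]
    rintro _ ⟨j, hj, rfl⟩
    rw [SetLike.mem_coe, RingHom.mem_ker]
    exact (sectionHom_linForm γ t j).trans (if_pos hj)

theorem sectionIdeal_bot_isPrime (t : ℕ) : (sectionIdeal ⊥ (linForm γ) t).IsPrime := by
  rw [← ker_sectionHom]
  exact RingHom.ker_isPrime _

theorem linForm_notMem_sectionIdeal_bot {t : ℕ} {j : Fin d} (h : (j : ℕ) < t) :
    linForm γ j ∉ sectionIdeal ⊥ (linForm γ) t := by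
  rw [← ker_sectionHom, RingHom.mem_ker]
  change sectionHom γ t _ ≠ 0
  rw [sectionHom_linForm, if_neg (not_le.mpr h)]
  exact X_ne_zero j

theorem sectionIdeal_bot_zero : sectionIdeal ⊥ (linForm γ) 0 = idealOfVars (Fin d) k := by
  refine le_antisymm ?_ ?_
  · rw [sectionIdeal, bot_sup_eq, Ideal.span_le]
    rintro _ ⟨j, _, rfl⟩
    exact mem_idealOfVars_of_isHomogeneous (n := 0) (isHomogeneous_linearForm _)
  · rw [← ker_sectionHom, idealOfVars, Ideal.span_le]
    rintro _ ⟨j, rfl⟩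
    rw [SetLike.mem_coe, RingHom.mem_ker]
    rw [sectionHom, AlgHom.comp_apply, substHom, aeval_X, linearForm, map_sum]
    refine Finset.sum_eq_zero fun i _ => ?_
    rw [map_mul, truncHom, aeval_X, if_pos (Nat.zero_le _), mul_zero]

theorem sectionIdeal_bot_le (I : Ideal (MvPolynomial (Fin d) k))
    (ℓ : Fin d → MvPolynomial (Fin d) k) (t : ℕ) : sectionIdeal ⊥ ℓ t ≤ sectionIdeal I ℓ t :=
  sup_le_sup_right bot_le _

theorem idealOfVars_le_sectionIdeal (I : Ideal (MvPolynomial (Fin d) k)) :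
    idealOfVars (Fin d) k ≤ sectionIdeal I (linForm γ) 0 := by
  rw [← sectionIdeal_bot_zero γ]
  exact sectionIdeal_bot_le _ _ _

/-- Exactness of the Koszul complex of the polynomial ring in positive degrees. -/
theorem torVanish_bot {i n : ℕ} (h : n ≠ 0 ∨ i ≠ 0) :
    TorVanish (⊥ : Ideal (MvPolynomial (Fin d) k)) i (i + n) := by
  have := torVanish_sectionIdeal (Ideal.IsHomogeneous.bot _)
    ((1 : Matrix.GeneralLinearGroup (Fin d) k) : Matrix (Fin d) (Fin d) k)
    (idealOfVars_le_sectionIdeal 1 ⊥) n d le_rfl ?_ i (by omega)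
  · rwa [sectionIdeal_of_le _ _ le_rfl] at this
  -- For I = 0 all section ideals are prime and do not contain the next form, so there are no
  -- defects at all.
  · rintro s _ ⟨p, _, hm, hp⟩
    have hprime := sectionIdeal_bot_isPrime (1 : Matrix.GeneralLinearGroup (Fin d) k) (s + 1)
    exact (hprime.mem_or_mem hm).elim
      (linForm_notMem_sectionIdeal_bot _ (Nat.lt_succ_self _)) hp

theorem exists_koszulD_eq {i n : ℕ} (h : n ≠ 0 ∨ i ≠ 0)
    {z : Finset (Fin d) → MvPolynomial (Fin d) k} (hz : z ∈ formChains k d i (i + n))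
    (hD : koszulD (k := k) z = 0) :
    ∃ w ∈ formChains k d (i + 1) (i + n), koszulD (k := k) w = z := by
  obtain ⟨w, hw, hw'⟩ := torVanish_bot h z hz (fun s => by rw [hD]; exact zero_mem _)
  refine ⟨w, hw, funext fun s => ?_⟩
  have := hw' s
  rw [Ideal.mem_bot, sub_eq_zero] at this
  exact this.symm

end SectionIdeals

/-! ### Regularity in terms of Koszul chains in the polynomial ring -/

section Regularity

variable {k : Type*} [Field k] {d : ℕ}

section General

variable {M : Type*} [AddCommGroup M] [Module (MvPolynomial (Fin d) k) M]
variable [Module k M] [IsScalarTower k (MvPolynomial (Fin d) k) M] {ℳ : ℕ → Submodule k M}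

theorem nontrivial_gradedTor_iff {i j : ℕ} :
    Nontrivial (GradedTor (d := d) ℳ i j) ↔ ∃ z ∈ koszulPiece (d := d) ℳ i j,
      koszulD (k := k) z = 0 ∧ ∀ w ∈ koszulPiece (d := d) ℳ (i + 1) j,
        koszulD (k := k) w ≠ z := by
  rw [GradedTor, Submodule.Quotient.nontrivial_iff, Submodule.submoduleOf, Ne,
    Submodule.comap_subtype_eq_top, SetLike.not_le_iff_exists]
  simp only [koszulCycles, koszulBoundaries, Submodule.mem_inf, LinearMap.mem_ker,
    LinearMap.coe_restrictScalars, Submodule.mem_map, not_exists, not_and, and_assoc, ne_eq]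

theorem le_of_nontrivial_gradedTor {i j : ℕ} (h : Nontrivial (GradedTor (d := d) ℳ i j)) :
    i ≤ j ∧ ℳ (j - i) ≠ ⊥ := by
  obtain ⟨z, hz, -, hw⟩ := nontrivial_gradedTor_iff.mp h
  have hz0 : z ≠ 0 := fun h0 => hw 0 (zero_mem _) (by rw [h0, map_zero])
  obtain ⟨s, hs⟩ := Function.ne_iff.mp hz0
  obtain ⟨h1, h2⟩ := mem_koszulPiece.mp hz
  have hsc : s.card = i ∧ i ≤ j := by
    by_contra hc
    exact hs (h2 s hc)
  exact ⟨hsc.2, fun hbot => hs (by simpa [hbot] using h1 s hsc.1 hsc.2)⟩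

theorem ereal_degree (i n : ℕ) :
    ((((i + n : ℕ) : ℝ) - (i : ℝ) : ℝ) : EReal) = ((n : ℝ) : EReal) := by
  congr 1; push_cast; ring

theorem reg_le_of_forall_eq_bot {e : ℕ} (h : ∀ n, e < n → ℳ n = ⊥) :
    reg d ℳ ≤ ((e : ℝ) : EReal) := by
  refine sSup_le ?_
  rintro _ ⟨i, j, hij, rfl⟩
  obtain ⟨hle, hne⟩ := le_of_nontrivial_gradedTor hij
  obtain ⟨n, rfl⟩ := Nat.exists_eq_add_of_le hle
  rw [ereal_degree]
  rw [Nat.add_sub_cancel_left] at hne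
  have : n ≤ e := by
    by_contra hc
    exact hne (h n (not_le.mp hc))
  exact_mod_cast this

/-- The regularity of a graded module with finitely many nonzero components is its top degree. -/
theorem reg_eq_of_top (hX : ∀ n, ∀ m ∈ ℳ n, ∀ a : Fin d,
      (X a : MvPolynomial (Fin d) k) • m ∈ ℳ (n + 1)) {e : ℕ} (he : ℳ e ≠ ⊥)
    (h : ∀ n, e < n → ℳ n = ⊥) : reg d ℳ = ((e : ℝ) : EReal) := by
  refine le_antisymm (reg_le_of_forall_eq_bot h) (le_sSup ⟨d, d + e, ?_, (ereal_degree d e).symm⟩)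
  obtain ⟨m, hm, hm0⟩ := Submodule.exists_mem_ne_zero_of_ne_bot he
  -- The class of m e_1 ∧ … ∧ e_d: the variables move m beyond the top degree, and nothing lives in
  -- homological degree d + 1.
  refine nontrivial_gradedTor_iff.mpr ⟨Pi.single Finset.univ m, mem_koszulPiece.mpr
    ⟨fun s hs _ => ?_, fun s hs => ?_⟩, funext fun s => ?_, fun w hw h0 => ?_⟩
  · rw [Nat.add_sub_cancel_left, Finset.card_eq_iff_eq_univ s |>.mp (by simpa using hs),
      Pi.single_eq_same]
    exact hm
  · refine Pi.single_eq_of_ne (fun h => hs ?_) _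
    rw [h, Finset.card_univ, Fintype.card_fin]
    exact ⟨rfl, Nat.le_add_right _ _⟩
  · rw [koszulD_apply]
    refine Finset.sum_eq_zero fun a _ => ?_
    by_cases hs : insert a s = Finset.univ
    · have := hX e m hm a
      rw [h _ (Nat.lt_succ_self e), Submodule.mem_bot] at this
      rw [hs, Pi.single_eq_same, mul_smul, this, smul_zero]
    · rw [Pi.single_eq_of_ne hs, smul_zero]
  · have hw0 : w = 0 := funext fun s => (mem_koszulPiece.mp hw).2 s fun hs => by
      have := s.card_le_univ
      rw [Fintype.card_fin] at this
      omega
    have := congrFun h0 Finset.univ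
    rw [hw0, map_zero, Pi.single_eq_same] at this
    exact hm0 this.symm

end General

theorem mem_subGrading {M : Type*} [AddCommGroup M] [Module (MvPolynomial (Fin d) k) M]
    [Module k M] [IsScalarTower k (MvPolynomial (Fin d) k) M] {ℳ : ℕ → Submodule k M}
    {N : Submodule (MvPolynomial (Fin d) k) M} {n : ℕ} {x : N} :
    x ∈ subGrading ℳ N n ↔ (x : M) ∈ ℳ n := Iff.rfl

theorem mem_koszulPiece_subGrading {J : Ideal (MvPolynomial (Fin d) k)} {i j : ℕ}
    {z : Finset (Fin d) → J} :
    z ∈ koszulPiece (d := d) (subGrading (homogeneousSubmodule (Fin d) k) J) i j ↔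
      (fun s => (z s : MvPolynomial (Fin d) k)) ∈ formChains k d i j := by
  simp only [mem_koszulPiece, mem_subGrading, ZeroMemClass.coe_eq_zero]

theorem coe_koszulD {J : Ideal (MvPolynomial (Fin d) k)} (z : Finset (Fin d) → J) :
    (fun s => ((koszulD (k := k) z s : J) : MvPolynomial (Fin d) k)) =
      koszulD (k := k) fun s => (z s : MvPolynomial (Fin d) k) := by
  funext s
  rw [koszulD_apply, koszulD_apply, AddSubmonoidClass.coe_finsetSum]
  rfl

/-- `Tor_i(J)_j` and `Tor_{i+1}(R / J)_j` vanish together. -/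
theorem nontrivial_gradedTor_ideal_iff {J : Ideal (MvPolynomial (Fin d) k)} {i n : ℕ}
    (h : n ≠ 0 ∨ i ≠ 0) :
    Nontrivial (GradedTor (d := d) (subGrading (homogeneousSubmodule (Fin d) k) J) i (i + n)) ↔
      ¬ TorVanish J (i + 1) (i + n) := by
  rw [nontrivial_gradedTor_iff, iff_not_comm]
  symm
  constructor
  · intro hz z hz1 hDz
    simp only [not_exists, not_and, not_forall, not_not, ne_eq] at hz
    -- The connecting map of 0 → J → R → R/J sends z to Dz. If Dz = Dw with w in J, then z - w is a
    -- cycle over R, hence a boundary.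
    have hDz1 := koszulD_mem_formChains' hz1
    obtain ⟨w, hw, hw'⟩ := hz (fun s => ⟨koszulD (k := k) z s, hDz s⟩)
      (mem_koszulPiece_subGrading.mpr hDz1) (by
        funext s
        refine Subtype.ext ?_
        have := congrFun (coe_koszulD fun s => (⟨koszulD (k := k) z s, hDz s⟩ : J)) s
        refine this.trans ?_
        change koszulD (k := k) (koszulD (k := k) z) s = _
        rw [koszulD_koszulD]; rfl)
    have hw1 := mem_koszulPiece_subGrading.mp hw
    have hDw : (koszulD (k := k) fun s => (w s : MvPolynomial (Fin d) k)) =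
        koszulD (k := k) z := by
      rw [← coe_koszulD, hw']
    have hdiff := sub_mem hz1 hw1
    have hker : koszulD (k := k) (z - fun s => (w s : MvPolynomial (Fin d) k)) = 0 := by
      rw [map_sub, hDw, sub_self]
    rcases n with _ | n
    · rw [formChains_eq_zero (by omega) hz1]
      exact ⟨0, zero_mem _, fun s => by simp⟩
    · rw [show i + (n + 1) = i + 1 + n by ring] at hdiff ⊢
      obtain ⟨v, hv, hv'⟩ := exists_koszulD_eq (Or.inr (Nat.succ_ne_zero i)) hdiff hker
      refine ⟨v, hv, fun s => ?_⟩
      rw [hv', Pi.sub_apply, sub_sub_cancel]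
      exact (w s).2
  · rintro hV ⟨z, hz, hDz, hw⟩
    have hz1 := mem_koszulPiece_subGrading.mp hz
    have hDz1 : (koszulD (k := k) fun s => (z s : MvPolynomial (Fin d) k)) = 0 := by
      rw [← coe_koszulD, hDz]; rfl
    -- Surjectivity of the connecting map: over R the cycle z bounds, unless i = n = 0.
    obtain ⟨w, hw1, hw2⟩ := exists_koszulD_eq h hz1 hDz1
    obtain ⟨v, hv, hv'⟩ := hV w hw1 (fun s => by rw [hw2]; exact (z s).2)
    refine hw (fun s => ⟨w s - koszulD (k := k) v s, hv' s⟩) (mem_koszulPiece_subGrading.mpr ?_) ?_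
    · exact sub_mem hw1 (koszulD_mem_formChains' hv)
    · funext s
      refine Subtype.ext ?_
      have := congrFun (coe_koszulD fun s => (⟨w s - koszulD (k := k) v s, hv' s⟩ : J)) s
      refine this.trans ?_
      change koszulD (k := k) (w - koszulD (k := k) v) s = _
      rw [koszulD_sub_koszulD, hw2]

/-- The shift by one comes from Tor_i(J) ≅ Tor_{i+1}(R/J). The strand j = i of Tor(J), where this
can fail, contributes only the value 0 and never exceeds m + 1. -/
theorem regIdeal_eq {J : Ideal (MvPolynomial (Fin d) k)} {m : ℕ}
    (h1 : ∃ i, ¬ TorVanish J (i + 1) (i + 1 + m))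
    (h2 : ∀ n, m < n → ∀ i, TorVanish J (i + 1) (i + 1 + n)) :
    regIdeal J = ((m : ℝ) : EReal) + 1 := by
  have hcast : ((m : ℝ) : EReal) + 1 = (((m + 1 : ℕ) : ℝ) : EReal) := by push_cast; rfl
  rw [hcast]
  refine le_antisymm (sSup_le ?_) (le_sSup ?_)
  · rintro _ ⟨i, j, hij, rfl⟩
    obtain ⟨hle, hne⟩ := le_of_nontrivial_gradedTor hij
    obtain ⟨n, rfl⟩ := Nat.exists_eq_add_of_le hle
    rw [ereal_degree]
    rcases n with _ | n
    · exact_mod_cast Nat.zero_le _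
    · have := (nontrivial_gradedTor_ideal_iff (Or.inl (Nat.succ_ne_zero n))).mp hij
      rw [show i + (n + 1) = i + 1 + n by ring] at this
      have hn : n ≤ m := by
        by_contra hc
        exact this (h2 n (not_le.mp hc) i)
      exact_mod_cast Nat.succ_le_succ hn
  · obtain ⟨i, hi⟩ := h1
    refine ⟨i, i + (m + 1), ?_, (ereal_degree i (m + 1)).symm⟩
    rw [nontrivial_gradedTor_ideal_iff (Or.inl (Nat.succ_ne_zero m)),
      show i + (m + 1) = i + 1 + m by ring]
    exact hi

end Regularity

/-! ### Annihilator modules and defects -/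

section AnnModule

variable {k : Type*} [Field k] {d : ℕ} {I : Ideal (MvPolynomial (Fin d) k)}

theorem mem_quotGrading {J : Ideal (MvPolynomial (Fin d) k)} {n : ℕ}
    {x : MvPolynomial (Fin d) k ⧸ J} :
    x ∈ quotGrading J n ↔ ∃ p : MvPolynomial (Fin d) k, p.IsHomogeneous n ∧
      Ideal.Quotient.mk J p = x := Iff.rfl

theorem mk_mem_annModule {ℓ : Fin d → MvPolynomial (Fin d) k} {t : Fin d}
    {p : MvPolynomial (Fin d) k} :
    Ideal.Quotient.mk (sectionIdeal I ℓ ((t : ℕ) + 1)) p ∈ annModule I ℓ t ↔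
      ℓ t * p ∈ sectionIdeal I ℓ (t + 1) := by
  rw [annModule, Submodule.mem_torsionBy_iff, ← Ideal.Quotient.eq_zero_iff_mem, map_mul]
  rfl

theorem annGrading_ne_bot_iff {ℓ : Fin d → MvPolynomial (Fin d) k} {t : Fin d} {n : ℕ} :
    annGrading I ℓ t n ≠ ⊥ ↔ ColonDefect I ℓ t n := by
  constructor
  · intro h
    obtain ⟨⟨x, hx⟩, hxn, hx0⟩ := Submodule.exists_mem_ne_zero_of_ne_bot h
    obtain ⟨p, hp, rfl⟩ := mem_quotGrading.mp hxn
    refine ⟨p, hp, mk_mem_annModule.mp hx, fun hc => hx0 ?_⟩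
    exact Subtype.ext (Ideal.Quotient.eq_zero_iff_mem.mpr hc)
  · rintro ⟨p, hp, hm, hc⟩ h
    have : (⟨Ideal.Quotient.mk _ p, mk_mem_annModule.mpr hm⟩ : annModule I ℓ t) ∈
        annGrading I ℓ t n := mem_quotGrading.mpr ⟨p, hp, rfl⟩
    rw [h, Submodule.mem_bot] at this
    exact hc (Ideal.Quotient.eq_zero_iff_mem.mp (congrArg Subtype.val this))

theorem annGrading_smul_mem {ℓ : Fin d → MvPolynomial (Fin d) k} {t : Fin d} (n : ℕ)
    (x : annModule I ℓ t) (hx : x ∈ annGrading I ℓ t n) (a : Fin d) :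
    (X a : MvPolynomial (Fin d) k) • x ∈ annGrading I ℓ t (n + 1) := by
  obtain ⟨p, hp, hpx⟩ := mem_quotGrading.mp hx
  refine mem_quotGrading.mpr ⟨X a * p, ?_, ?_⟩
  · rw [add_comm]; exact (isHomogeneous_X k a).mul hp
  · rw [map_mul]; erw [hpx]; rfl

instance finite_homogeneousSubmodule (n : ℕ) :
    Module.Finite k (homogeneousSubmodule (Fin d) k n) :=
  Module.Finite.iff_fg.mpr (homogeneousSubmodule_fg _ _ n)

instance finite_quotGrading (J : Ideal (MvPolynomial (Fin d) k)) (n : ℕ) :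
    Module.Finite k (quotGrading J n) :=
  Module.Finite.iff_fg.mpr ((homogeneousSubmodule_fg _ _ n).map _)

instance finite_annGrading (ℓ : Fin d → MvPolynomial (Fin d) k) (t : Fin d) (n : ℕ) :
    Module.Finite k (annGrading I ℓ t n) := by
  let f : annGrading I ℓ t n →ₗ[k] quotGrading (sectionIdeal I ℓ ((t : ℕ) + 1)) n :=
    { toFun := fun x => ⟨x.1.1, x.2⟩
      map_add' := fun _ _ => rfl
      map_smul' := fun _ _ => rfl }
  refine Module.Finite.of_injective f fun x y h => ?_
  have h' := congrArg Subtype.val h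
  exact Subtype.ext (Subtype.ext h')

theorem annNumber_ne_zero_iff {ℓ : Fin d → MvPolynomial (Fin d) k} {s : Fin d} {n : ℕ} :
    annNumber I ℓ s n ≠ 0 ↔ ColonDefect I ℓ s.rev n := by
  rw [annNumber, ← annGrading_ne_bot_iff, Ne, Submodule.finrank_eq_zero]

theorem reg_annGrading_le {ℓ : Fin d → MvPolynomial (Fin d) k} {t : Fin d} {m : ℕ}
    (h : ∀ n, ColonDefect I ℓ t n → n ≤ m) :
    reg d (annGrading I ℓ t) ≤ ((m : ℝ) : EReal) := by
  refine reg_le_of_forall_eq_bot fun n hn => ?_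
  by_contra hc
  exact absurd (h n (annGrading_ne_bot_iff.mp hc)) (not_le.mpr hn)

theorem reg_annGrading_eq {ℓ : Fin d → MvPolynomial (Fin d) k} {t : Fin d} {m : ℕ}
    (hm : ColonDefect I ℓ t m) (h : ∀ n, ColonDefect I ℓ t n → n ≤ m) :
    reg d (annGrading I ℓ t) = ((m : ℝ) : EReal) := by
  refine reg_eq_of_top annGrading_smul_mem (annGrading_ne_bot_iff.mpr hm) fun n hn => ?_
  by_contra hc
  exact absurd (h n (annGrading_ne_bot_iff.mp hc)) (not_le.mpr hn)

/-- Almost regularity means that the multiplications are injective in large degrees. -/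
theorem isAlmostRegular_iff (hI : I.IsHomogeneous (homogeneousSubmodule (Fin d) k))
    {ℓ : Fin d → MvPolynomial (Fin d) k} (hℓ : ∀ j, (ℓ j).IsHomogeneous 1) :
    IsAlmostRegular I ℓ ↔ ∀ t, ∃ N, ∀ n, N ≤ n → ¬ ColonDefect I ℓ t n := by
  refine forall_congr' fun t => ?_
  have hJ := sectionIdeal_isHomogeneous hI hℓ (t + 1)
  constructor
  · intro hfin
    obtain ⟨S, hS⟩ := hfin.fg_top
    choose q hq using fun x : annModule I ℓ t => Ideal.Quotient.mk_surjective x.1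
    refine ⟨(S.sup fun x => (q x).totalDegree) + 1, fun n hn => ?_⟩
    rintro ⟨p, hp, hm, hc⟩
    have hx : (⟨Ideal.Quotient.mk _ p, mk_mem_annModule.mpr hm⟩ : annModule I ℓ t) ∈
        Submodule.span k (S : Set (annModule I ℓ t)) := by rw [hS]; trivial
    obtain ⟨c, hc'⟩ := Submodule.mem_span_finset.mp hx |>.imp fun _ h => h.2
    have hdiff : p - ∑ x ∈ S, C (c x) * q x ∈ sectionIdeal I ℓ (t + 1) := by
      rw [← Ideal.Quotient.eq_zero_iff_mem, map_sub, map_sum, sub_eq_zero]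
      have := congrArg (annModule I ℓ t).subtype hc'.symm
      rw [map_sum] at this
      refine this.trans (Finset.sum_congr rfl fun x _ => ?_)
      rw [map_mul, hq, ← algebraMap_eq]
      change c x • (x : MvPolynomial (Fin d) k ⧸ sectionIdeal I ℓ (t + 1)) = _
      exact (algebraMap_smul (MvPolynomial (Fin d) k) (c x) _).symm
    have := component_mem hJ hdiff n
    rw [map_sub, map_sum, homogeneousComponent_of_isHomogeneous hp, Finset.sum_eq_zero,
      sub_zero] at this
    · exact hc this
    · intro x hx
      rw [homogeneousComponent_C_mul, homogeneousComponent_eq_zero, mul_zero]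
      have : (q x).totalDegree ≤ S.sup fun x => (q x).totalDegree :=
        Finset.le_sup (f := fun x => (q x).totalDegree) hx
      omega
  · rintro ⟨N, hN⟩
    let V : Submodule k (MvPolynomial (Fin d) k ⧸ sectionIdeal I ℓ ((t : ℕ) + 1)) :=
      ⨆ n : Fin N, quotGrading (sectionIdeal I ℓ ((t : ℕ) + 1)) n
    have hV : ∀ x ∈ annModule I ℓ t, x ∈ V := by
      intro x hx
      obtain ⟨p, rfl⟩ := Ideal.Quotient.mk_surjective x
      rw [← sum_homogeneousComponent p, map_sum]
      refine Submodule.sum_mem _ fun n _ => ?_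
      rcases lt_or_ge n N with h | h
      · exact (le_iSup (fun n : Fin N => quotGrading (sectionIdeal I ℓ ((t : ℕ) + 1)) n) ⟨n, h⟩)
          ⟨_, homogeneousComponent_isHomogeneous n p, rfl⟩
      · have hm := component_mem hJ (mk_mem_annModule.mp hx) (1 + n)
        rw [homogeneousComponent_mul_add (hℓ t)] at hm
        rw [Ideal.Quotient.eq_zero_iff_mem.mpr (mem_of_not_colonDefect (hN n h)
          (homogeneousComponent_isHomogeneous n p) hm)]
        exact zero_mem _
    let f : annModule I ℓ t →ₗ[k] V :=
      { toFun := fun x => ⟨x.1, hV x.1 x.2⟩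
        map_add' := fun _ _ => rfl
        map_smul' := fun _ _ => rfl }
    refine Module.Finite.of_injective f fun x y h => ?_
    have h' := congrArg Subtype.val h
    exact Subtype.ext h'

end AnnModule

/-! ### The formula for fixed almost regular coordinates -/

section FixedCoordinates

variable {k : Type*} [Field k] {d : ℕ}

theorem sectionIdeal_antitone (I : Ideal (MvPolynomial (Fin d) k))
    (ℓ : Fin d → MvPolynomial (Fin d) k) : Antitone (sectionIdeal I ℓ) := fun _ _ h =>
  sup_le_sup_left (Ideal.span_mono (Set.image_mono fun _ hj => le_trans h hj)) _

theorem isHomogeneous_linForm (γ : Matrix.GeneralLinearGroup (Fin d) k) (i : Fin d) :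
    (linForm γ i).IsHomogeneous 1 := isHomogeneous_linearForm _

/-- The ring R/(L + (ℓ^n)) is filtered by copies of the domain R/(L + (ℓ)), on which y is a
nonzerodivisor; the induction peels off one factor ℓ at a time. -/
theorem mem_sup_span_pow_of_mul_mem {R : Type*} [CommRing R] {L : Ideal R} {ℓ y : R}
    (hL : L.IsPrime) (hLℓ : (L ⊔ Ideal.span {ℓ}).IsPrime) (hℓ : ℓ ∉ L)
    (hy : y ∉ L ⊔ Ideal.span {ℓ}) (n : ℕ) {g : R} (h : y * g ∈ L ⊔ Ideal.span {ℓ ^ n}) :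
    g ∈ L ⊔ Ideal.span {ℓ ^ n} := by
  induction n generalizing g with
  | zero => simp
  | succ n ih =>
    have hle : L ⊔ Ideal.span {ℓ ^ (n + 1)} ≤ L ⊔ Ideal.span {ℓ} :=
      sup_le_sup_left (Ideal.span_singleton_le_span_singleton.mpr (dvd_pow_self ℓ n.succ_ne_zero)) _
    have hg := (hLℓ.mem_or_mem (hle h)).resolve_left hy
    obtain ⟨a, ha, b, hb, hab⟩ := Submodule.mem_sup.mp h
    obtain ⟨r, rfl⟩ := Ideal.mem_span_singleton'.mp hb
    obtain ⟨a', ha', b', hb', rfl⟩ := Submodule.mem_sup.mp hg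
    obtain ⟨g', rfl⟩ := Ideal.mem_span_singleton'.mp hb'
    have h1 : ℓ * (y * g' - r * ℓ ^ n) ∈ L := by
      have : ℓ * (y * g' - r * ℓ ^ n) = a - y * a' := by
        linear_combination -hab
      rw [this]
      exact sub_mem ha (Ideal.mul_mem_left _ _ ha')
    have h2 := (hL.mem_or_mem h1).resolve_left hℓ
    have h3 : g' ∈ L ⊔ Ideal.span {ℓ ^ n} := by
      refine ih ?_
      have := add_mem (Ideal.mem_sup_left (T := Ideal.span {ℓ ^ n}) h2)
        (Ideal.mem_sup_right (S := L) (Ideal.mul_mem_left _ r (Ideal.mem_span_singleton_self _)))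
      rwa [sub_add_cancel] at this
    obtain ⟨a₂, ha₂, b₂, hb₂, rfl⟩ := Submodule.mem_sup.mp h3
    obtain ⟨r₂, rfl⟩ := Ideal.mem_span_singleton'.mp hb₂
    refine add_mem (Ideal.mem_sup_left ha') ?_
    rw [show (a₂ + r₂ * ℓ ^ n) * ℓ = a₂ * ℓ + r₂ * ℓ ^ (n + 1) by ring]
    exact add_mem (Ideal.mem_sup_left (Ideal.mul_mem_right _ _ ha₂))
      (Ideal.mem_sup_right (Ideal.mul_mem_left _ _ (Ideal.mem_span_singleton_self _)))

variable {I : Ideal (MvPolynomial (Fin d) k)}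

theorem le_of_isHomogeneous_imp {J L : Ideal (MvPolynomial (Fin d) k)}
    (hJ : J.IsHomogeneous (homogeneousSubmodule (Fin d) k))
    (h : ∀ n, ∀ p : MvPolynomial (Fin d) k, p.IsHomogeneous n → p ∈ J → p ∈ L) : J ≤ L := by
  intro p hp
  rw [← sum_homogeneousComponent p]
  exact sum_mem fun n _ => h n _ (homogeneousComponent_isHomogeneous n p) (component_mem hJ hp n)

/-- Modulo the linear forms, an element of J_{t+1} is ℓ_t u; with no defects u lies in J_{t+1}
again, and its degree is smaller. -/
theorem sectionIdeal_le_of_colonDefect_zero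
    (hI : I.IsHomogeneous (homogeneousSubmodule (Fin d) k))
    (γ : Matrix.GeneralLinearGroup (Fin d) k) {t : Fin d}
    (hle : sectionIdeal I (linForm γ) (t + 1) ≤ sectionIdeal ⊥ (linForm γ) t)
    (hE : ∀ n, ¬ ColonDefect I (linForm γ) t n) :
    sectionIdeal I (linForm γ) (t + 1) ≤ sectionIdeal ⊥ (linForm γ) (t + 1) := by
  have hJ := sectionIdeal_isHomogeneous hI (isHomogeneous_linForm γ) (t + 1)
  have hL := sectionIdeal_isHomogeneous (Ideal.IsHomogeneous.bot _) (isHomogeneous_linForm γ) (t + 1)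
  rw [sectionIdeal_eq_sup] at hle
  refine le_of_isHomogeneous_imp hJ fun n => ?_
  induction n with
  | zero =>
    intro p hp hpJ
    exact mem_of_mem_sup_span_singleton hL (isHomogeneous_linForm γ t) (hle hpJ) hp
  | succ n ih =>
    intro p hp hpJ
    obtain ⟨u, hu, hpu⟩ := exists_sub_mul_mem hL (isHomogeneous_linForm γ t) (hle hpJ) hp
    have h1 := sub_mem hpJ (sectionIdeal_bot_le I _ _ hpu)
    rw [sub_sub_cancel] at h1
    have h2 := ih u hu (mem_of_not_colonDefect (hE n) hu h1)
    have := add_mem hpu (Ideal.mul_mem_left _ (linForm γ t) h2)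
    rwa [sub_add_cancel] at this

/-- Cancelling ℓ_t is allowed only in degrees at least N, so descent on degrees breaks down.
Multiplying first by y = ℓ_0, which is available since t > 0, compensates the degree lost in
dividing by ℓ_t. Cancelling y afterwards puts g in L + (ℓ_t^q) for every q, where L is generated by
the later forms; taking q beyond the degree of g gives g ∈ L. -/
theorem sectionIdeal_le_of_colonDefect
    (hI : I.IsHomogeneous (homogeneousSubmodule (Fin d) k))
    (γ : Matrix.GeneralLinearGroup (Fin d) k) {t : Fin d} (ht : 0 < (t : ℕ))
    (hle : sectionIdeal I (linForm γ) (t + 1) ≤ sectionIdeal ⊥ (linForm γ) t) {N : ℕ}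
    (hE : ∀ n, N ≤ n → ¬ ColonDefect I (linForm γ) t n) :
    sectionIdeal I (linForm γ) (t + 1) ≤ sectionIdeal ⊥ (linForm γ) (t + 1) := by
  have hJ := sectionIdeal_isHomogeneous hI (isHomogeneous_linForm γ) (t + 1)
  have hL := sectionIdeal_isHomogeneous (Ideal.IsHomogeneous.bot _) (isHomogeneous_linForm γ) (t + 1)
  have hLp := sectionIdeal_bot_isPrime γ (t + 1)
  have hLp' := sectionIdeal_bot_isPrime γ t
  set y := linForm γ ⟨0, ht.trans t.2⟩
  have hyhom : y.IsHomogeneous 1 := isHomogeneous_linForm γ _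
  have hy : y ∉ sectionIdeal ⊥ (linForm γ) t := linForm_notMem_sectionIdeal_bot γ ht
  have hℓ : linForm γ t ∉ sectionIdeal ⊥ (linForm γ) (t + 1) :=
    linForm_notMem_sectionIdeal_bot γ (Nat.lt_succ_self _)
  have hyL : y ∉ sectionIdeal ⊥ (linForm γ) (t + 1) :=
    fun h => hy (sectionIdeal_antitone _ _ (Nat.le_succ _) h)
  rw [sectionIdeal_eq_sup] at hle hy hLp'
  have key : ∀ q n, N ≤ n → ∀ g : MvPolynomial (Fin d) k, g.IsHomogeneous n →
      g ∈ sectionIdeal I (linForm γ) (t + 1) →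
      g ∈ sectionIdeal ⊥ (linForm γ) (t + 1) ⊔ Ideal.span {linForm γ t ^ q} := by
    intro q
    induction q with
    | zero => intros; simp
    | succ q ih =>
      intro n hn g hg hgJ
      have hyg : (y * g).IsHomogeneous (n + 1) := by
        rw [add_comm]; exact hyhom.mul hg
      obtain ⟨u, hu, hpu⟩ := exists_sub_mul_mem hL (isHomogeneous_linForm γ t)
        (hle (Ideal.mul_mem_left _ y hgJ)) hyg
      have h1 := sub_mem (Ideal.mul_mem_left _ y hgJ) (sectionIdeal_bot_le I _ _ hpu)
      rw [sub_sub_cancel] at h1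
      have h2 := ih n hn u hu (mem_of_not_colonDefect (hE n hn) hu h1)
      refine mem_sup_span_pow_of_mul_mem hLp hLp' hℓ hy (q + 1) ?_
      obtain ⟨a₂, ha₂, b₂, hb₂, rfl⟩ := Submodule.mem_sup.mp h2
      obtain ⟨r₂, rfl⟩ := Ideal.mem_span_singleton'.mp hb₂
      rw [← sub_add_cancel (y * g) (linForm γ t * (a₂ + r₂ * linForm γ t ^ q))]
      refine add_mem (Ideal.mem_sup_left hpu) ?_
      rw [show linForm γ t * (a₂ + r₂ * linForm γ t ^ q) =
        linForm γ t * a₂ + r₂ * linForm γ t ^ (q + 1) by ring]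
      exact add_mem (Ideal.mem_sup_left (Ideal.mul_mem_left _ _ ha₂))
        (Ideal.mem_sup_right (Ideal.mul_mem_left _ _ (Ideal.mem_span_singleton_self _)))
  have key2 : ∀ n, N ≤ n → ∀ g : MvPolynomial (Fin d) k, g.IsHomogeneous n →
      g ∈ sectionIdeal I (linForm γ) (t + 1) → g ∈ sectionIdeal ⊥ (linForm γ) (t + 1) := by
    intro n hn g hg hgJ
    obtain ⟨a, ha, b, hb, hab⟩ := Submodule.mem_sup.mp (key (n + 1) n hn g hg hgJ)
    obtain ⟨r, rfl⟩ := Ideal.mem_span_singleton'.mp hb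
    have hpow := (isHomogeneous_linForm γ t).pow (n + 1)
    rw [one_mul] at hpow
    rw [← homogeneousComponent_of_isHomogeneous hg, ← hab, map_add, mul_comm r,
      homogeneousComponent_mul_of_lt hpow (Nat.lt_succ_self n), add_zero]
    exact component_mem hL ha n
  refine le_of_isHomogeneous_imp hJ fun n p hp hpJ => ?_
  have hyN := hyhom.pow N
  rw [one_mul] at hyN
  -- Elements of low degree are lifted into the good range by y^N, which is then cancelled modulo
  -- the prime L.
  have := key2 (N + n) (Nat.le_add_right _ _) (y ^ N * p) (hyN.mul hp)
    (Ideal.mul_mem_left _ _ hpJ)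
  exact (hLp.mem_or_mem this).resolve_left fun h => hyL (hLp.mem_of_pow_mem _ h)

theorem le_idealOfVars (hI : I.IsHomogeneous (homogeneousSubmodule (Fin d) k)) (htop : I ≠ ⊤) :
    I ≤ idealOfVars (Fin d) k := by
  refine le_of_isHomogeneous_imp hI fun n p hp hpI => ?_
  rcases n with _ | n
  · obtain ⟨a, rfl⟩ : ∃ a, p = C a := by
      refine ⟨_, (totalDegree_eq_zero_iff_eq_C.mp ?_)⟩
      exact Nat.le_zero.mp hp.totalDegree_le
    by_cases ha : a = 0
    · rw [ha, map_zero]; exact zero_mem _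
    · exact absurd (Ideal.eq_top_of_isUnit_mem _ hpI ((isUnit_iff_ne_zero.mpr ha).map C)) htop
  · exact mem_idealOfVars_of_isHomogeneous hp

/-- Without such a defect, containment in the ideal of the linear forms would propagate from t = 0
up to t = d, giving I = 0. As t = 0 is admissible for each i ≥ 1, no maximum is over an empty set.
-/
theorem exists_colonDefect_zero
    (hI : I.IsHomogeneous (homogeneousSubmodule (Fin d) k))
    (γ : Matrix.GeneralLinearGroup (Fin d) k) (hbot : I ≠ ⊥) (htop : I ≠ ⊤) (hd : 0 < d)
    (har : IsAlmostRegular I (linForm γ)) : ∃ n, ColonDefect I (linForm γ) ⟨0, hd⟩ n := by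
  by_contra! hc
  rw [isAlmostRegular_iff hI (isHomogeneous_linForm γ)] at har
  have hstep : ∀ t, t ≤ d → sectionIdeal I (linForm γ) t ≤ sectionIdeal ⊥ (linForm γ) t := by
    intro t
    induction t with
    | zero =>
      intro _
      rw [sectionIdeal_bot_zero]
      refine sup_le (le_idealOfVars hI htop) ?_
      rw [← sectionIdeal_bot_zero γ]
      exact le_sup_right
    | succ t ih =>
      intro ht
      have hle := (sectionIdeal_antitone I (linForm γ) (Nat.le_succ t)).trans (ih (by omega))
      rcases Nat.eq_zero_or_pos t with rfl | h0
      · exact sectionIdeal_le_of_colonDefect_zero hI γ (t := ⟨0, hd⟩) hle hc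
      · obtain ⟨N, hN⟩ := har ⟨t, ht⟩
        exact sectionIdeal_le_of_colonDefect hI γ (t := ⟨t, ht⟩) h0 hle hN
  have := hstep d le_rfl
  rw [sectionIdeal_of_le _ _ le_rfl, sectionIdeal_of_le _ _ le_rfl] at this
  exact hbot (le_bot_iff.mp this)

theorem exists_isGreatest_colonDefect
    (hI : I.IsHomogeneous (homogeneousSubmodule (Fin d) k))
    (γ : Matrix.GeneralLinearGroup (Fin d) k) (hbot : I ≠ ⊥) (htop : I ≠ ⊤)
    (har : IsAlmostRegular I (linForm γ)) {i : ℕ} (hi : 1 ≤ i) (hid : i ≤ d) :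
    ∃ m, IsGreatest {n : ℕ | ∃ t : Fin d, (t : ℕ) + 1 ≤ i ∧ ColonDefect I (linForm γ) t n} m := by
  obtain ⟨n, hn⟩ := exists_colonDefect_zero hI γ hbot htop (by omega) har
  rw [isAlmostRegular_iff hI (isHomogeneous_linForm γ)] at har
  choose N hN using har
  have hbdd : BddAbove {n : ℕ | ∃ t : Fin d, (t : ℕ) + 1 ≤ i ∧ ColonDefect I (linForm γ) t n} := by
    refine ⟨Finset.univ.sup N, ?_⟩
    rintro m ⟨t, -, ht⟩
    by_contra hc
    exact hN t m ((Finset.le_sup (Finset.mem_univ t)).trans (not_le.mp hc).le) ht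
  exact ⟨_, Nat.sSup_mem ⟨n, ⟨0, by omega⟩, by simpa using hi, hn⟩ hbdd, fun x hx => le_csSup hbdd hx⟩

/-- For the lower bound, a defect p of degree m is a socle element of R/J_{t+1}: the products x_a p
are killed by ℓ_t in degree m + 1, where no defects remain. Were the strand m of R/J_i zero in
positive homological degrees, `TorVanish.sup` would carry the vanishing down to R/J_{t+1}, against
`not_torVanish_of_socle`. -/
theorem regIdeal_sectionIdeal_eq
    (hI : I.IsHomogeneous (homogeneousSubmodule (Fin d) k))
    (γ : Matrix.GeneralLinearGroup (Fin d) k) {i m : ℕ} (hid : i ≤ d)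
    (hm : IsGreatest {n : ℕ | ∃ t : Fin d, (t : ℕ) + 1 ≤ i ∧ ColonDefect I (linForm γ) t n} m) :
    regIdeal (sectionIdeal I (linForm γ) i) = ((m : ℝ) : EReal) + 1 := by
  have hno : ∀ n, m < n → ∀ t : Fin d, (t : ℕ) < i → ¬ ColonDefect I (linForm γ) t n :=
    fun n hn t ht hE => absurd (hm.2 ⟨t, ht, hE⟩) (not_le.mpr hn)
  obtain ⟨t, ht, p, hp, hpm, hpJ⟩ := hm.1
  refine regIdeal_eq ?_ fun n hn h => ?_
  · by_contra! hc
    -- Each of the q forms added costs one homological degree; for q = i - (t + 1) degree d is still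
    -- reached because i ≤ d.
    have key : ∀ q, q + (t + 1) ≤ i → ∀ h, 1 + q ≤ h →
        TorVanish (sectionIdeal I (linForm γ) (i - q)) h (h + m) := by
      intro q
      induction q with
      | zero =>
        intro _ h hh
        obtain ⟨h, rfl⟩ := Nat.exists_eq_add_of_le' hh
        exact hc h
      | succ q ih =>
        intro hq h hh
        obtain ⟨h, rfl⟩ := Nat.exists_eq_add_of_le' (show 1 ≤ h by omega)
        have hs := sectionIdeal_eq_sup I (linForm γ) ⟨i - (q + 1), by omega⟩
        simp only [show i - (q + 1) + 1 = i - q by omega] at hs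
        rw [hs]
        refine TorVanish.sup (sectionIdeal_isHomogeneous hI (isHomogeneous_linForm γ) _)
          (isHomogeneous_linForm γ _) ?_ (ih (by omega) h (by omega))
          (ih (by omega) (h + 1) (by omega))
        intro p hp hpm
        have := hno (m + 1) (Nat.lt_succ_self m) ⟨i - (q + 1), by omega⟩
          (show i - (q + 1) < i by omega)
        have := mem_of_not_colonDefect this hp
        simp only [show i - (q + 1) + 1 = i - q by omega] at this
        exact this hpm
    have := key (i - (t + 1)) (by omega) d (by omega)
    rw [show i - (i - ((t : ℕ) + 1)) = t + 1 by omega] at this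
    refine not_torVanish_of_socle hp hpJ (fun a => ?_) this
    refine mem_of_not_colonDefect (hno (m + 1) (Nat.lt_succ_self m) t ht)
      (n := m + 1) ?_ ?_
    · rw [add_comm]; exact (isHomogeneous_X k a).mul hp
    · rw [mul_left_comm]; exact Ideal.mul_mem_left _ _ hpm
  · exact torVanish_sectionIdeal hI (γ : Matrix (Fin d) (Fin d) k)
      (idealOfVars_le_sectionIdeal γ I) n i hid (fun s hs => hno n hn s hs) (h + 1)
      (Or.inl (by omega))

theorem isGreatest_reg_annGrading {ℓ : Fin d → MvPolynomial (Fin d) k} {i m : ℕ}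
    (hm : IsGreatest {n : ℕ | ∃ t : Fin d, (t : ℕ) + 1 ≤ i ∧ ColonDefect I ℓ t n} m) :
    IsGreatest {r : EReal | ∃ t : Fin d, (t : ℕ) + 1 ≤ i ∧ r = reg d (annGrading I ℓ t)}
      ((m : ℝ) : EReal) := by
  have hle : ∀ t : Fin d, (t : ℕ) + 1 ≤ i → ∀ n, ColonDefect I ℓ t n → n ≤ m :=
    fun t ht n hn => hm.2 ⟨t, ht, hn⟩
  constructor
  · obtain ⟨t, ht, hE⟩ := hm.1
    exact ⟨t, ht, (reg_annGrading_eq hE (hle t ht)).symm⟩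
  · rintro _ ⟨t, ht, rfl⟩
    exact reg_annGrading_le (hle t ht)

theorem isGreatest_annNumber {ℓ : Fin d → MvPolynomial (Fin d) k} {i m : ℕ}
    (hm : IsGreatest {n : ℕ | ∃ t : Fin d, (t : ℕ) + 1 ≤ i ∧ ColonDefect I ℓ t n} m) :
    IsGreatest {j : ℕ | ∃ s : Fin d, d - i ≤ (s : ℕ) ∧ annNumber I ℓ s j ≠ 0} m := by
  convert hm using 1
  ext j
  constructor
  · rintro ⟨s, hs, hj⟩
    refine ⟨s.rev, ?_, annNumber_ne_zero_iff.mp hj⟩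
    rw [Fin.val_rev]; omega
  · rintro ⟨t, ht, hj⟩
    refine ⟨t.rev, ?_, annNumber_ne_zero_iff.mpr (by rwa [Fin.rev_rev])⟩
    rw [Fin.val_rev]; omega

end FixedCoordinates

/-! ### Persistence of injectivity in higher degrees -/

section Persistence

variable {k : Type*} [Field k] {d : ℕ}

theorem single_empty_mem_formChains {p : MvPolynomial (Fin d) k} {n : ℕ} (hp : p.IsHomogeneous n) :
    (Pi.single ∅ p : Finset (Fin d) → MvPolynomial (Fin d) k) ∈ formChains k d 0 (0 + n) := by
  refine mem_formChains.mpr ⟨fun s => ?_, fun s hs => ?_⟩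
  · by_cases hs : s = ∅
    · subst hs; rwa [Pi.single_eq_same]
    · rw [Pi.single_eq_of_ne hs]; exact isHomogeneous_zero _ _ _
  · exact Pi.single_eq_of_ne (fun h => hs (by rw [h, Finset.card_empty])) _

theorem koszulD_apply_empty (w : Finset (Fin d) → MvPolynomial (Fin d) k) :
    koszulD (k := k) w ∅ = ∑ a, X a * w {a} := by
  rw [koszulD_apply, Finset.compl_empty]
  refine Finset.sum_congr rfl fun a _ => ?_
  rw [Finset.filter_empty, Finset.card_empty, pow_zero, one_mul, insert_empty_eq, smul_eq_mul]

/-- Forms of positive degree are combinations of the variables with homogeneous coefficients. -/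
theorem exists_eq_sum_X_mul {p : MvPolynomial (Fin d) k} {n : ℕ} (hp : p.IsHomogeneous (n + 1)) :
    ∃ q : Fin d → MvPolynomial (Fin d) k, (∀ a, (q a).IsHomogeneous n) ∧ p = ∑ a, X a * q a := by
  have hz := single_empty_mem_formChains hp
  obtain ⟨w, hw, hw'⟩ := exists_koszulD_eq (Or.inl (Nat.succ_ne_zero n)) hz
    (koszulD_eq_zero_of_mem_formChains_zero hz)
  rw [show 0 + (n + 1) = 0 + 1 + n by ring] at hw
  refine ⟨fun a => w {a}, fun a => (mem_formChains.mp hw).1 _, ?_⟩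
  rw [← koszulD_apply_empty, hw', Pi.single_eq_same]

/-- The components of `J` in degrees above `g` are generated by the previous ones. -/
def GeneratedUpTo (J : Ideal (MvPolynomial (Fin d) k)) (g : ℕ) : Prop :=
  ∀ n, g ≤ n → ∀ p ∈ J, p.IsHomogeneous (n + 1) →
    ∃ q : Fin d → MvPolynomial (Fin d) k,
      (∀ a, (q a).IsHomogeneous n ∧ q a ∈ J) ∧ p = ∑ a, X a * q a

theorem GeneratedUpTo.mono {J : Ideal (MvPolynomial (Fin d) k)} {g g' : ℕ}
    (h : GeneratedUpTo J g) (hg : g ≤ g') : GeneratedUpTo J g' :=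
  fun n hn => h n (hg.trans hn)

theorem exists_generatedUpTo {J : Ideal (MvPolynomial (Fin d) k)}
    (hJ : J.IsHomogeneous (homogeneousSubmodule (Fin d) k)) : ∃ g, GeneratedUpTo J g := by
  obtain ⟨S, hS⟩ := (isNoetherianRing_iff_ideal_fg _).mp inferInstance J
  refine ⟨S.sup fun s => s.totalDegree, fun n hn p hp hpn => ?_⟩
  have hadd : ∀ p₁ p₂ : MvPolynomial (Fin d) k,
      (∃ q : Fin d → MvPolynomial (Fin d) k,
        (∀ a, (q a).IsHomogeneous n ∧ q a ∈ J) ∧ p₁ = ∑ a, X a * q a) →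
      (∃ q : Fin d → MvPolynomial (Fin d) k,
        (∀ a, (q a).IsHomogeneous n ∧ q a ∈ J) ∧ p₂ = ∑ a, X a * q a) →
      ∃ q : Fin d → MvPolynomial (Fin d) k,
        (∀ a, (q a).IsHomogeneous n ∧ q a ∈ J) ∧ p₁ + p₂ = ∑ a, X a * q a := by
    rintro _ _ ⟨q₁, h₁, rfl⟩ ⟨q₂, h₂, rfl⟩
    refine ⟨q₁ + q₂, fun a => ⟨(h₁ a).1.add (h₂ a).1, add_mem (h₁ a).2 (h₂ a).2⟩, ?_⟩
    simp only [Pi.add_apply, mul_add, Finset.sum_add_distrib]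
  have hzero : ∃ q : Fin d → MvPolynomial (Fin d) k,
      (∀ a, (q a).IsHomogeneous n ∧ q a ∈ J) ∧ 0 = ∑ a, X a * q a :=
    ⟨0, fun a => ⟨isHomogeneous_zero _ _ _, zero_mem _⟩, by simp⟩
  rw [← hS] at hp
  obtain ⟨c, -, hc⟩ := Submodule.mem_span_finset.mp hp
  rw [← homogeneousComponent_of_isHomogeneous hpn, ← hc, map_sum]
  refine Finset.sum_induction _ _ hadd hzero fun s hs => ?_
  have hsJ : s ∈ J := hS ▸ Submodule.subset_span hs
  generalize c s = b
  rw [← sum_homogeneousComponent s, Finset.smul_sum, map_sum]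
  refine Finset.sum_induction _ _ hadd hzero fun i hi => ?_
  have hdeg : s.totalDegree ≤ S.sup fun s => s.totalDegree :=
    Finset.le_sup (f := fun s : MvPolynomial (Fin d) k => s.totalDegree) hs
  obtain ⟨e, rfl⟩ := Nat.exists_eq_add_of_le
    (show i ≤ n by have := Finset.mem_range.mp hi; omega)
  -- A component of a generator has degree i ≤ n, so its cofactor has positive degree e + 1 and a
  -- variable can be split off.
  rw [smul_eq_mul, mul_comm, add_assoc,
    homogeneousComponent_mul_add (homogeneousComponent_isHomogeneous i s)]
  obtain ⟨q, hq, hq'⟩ := exists_eq_sum_X_mul (homogeneousComponent_isHomogeneous (e + 1) b)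
  refine ⟨fun a => homogeneousComponent i s * q a, fun a =>
    ⟨(homogeneousComponent_isHomogeneous i s).mul (hq a),
      Ideal.mul_mem_right _ _ (component_mem hJ hsJ i)⟩, ?_⟩
  rw [hq', Finset.mul_sum]
  exact Finset.sum_congr rfl fun a _ => by ring

/-- The bound g ≥ 1 accounts for the new generator ℓ of degree 1: above it, the cofactor of ℓ has
positive degree. -/
theorem GeneratedUpTo.sup {J : Ideal (MvPolynomial (Fin d) k)}
    (hJ : J.IsHomogeneous (homogeneousSubmodule (Fin d) k)) {ℓ : MvPolynomial (Fin d) k}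
    (hℓ : ℓ.IsHomogeneous 1) {g : ℕ} (hg : 1 ≤ g) (h : GeneratedUpTo J g) :
    GeneratedUpTo (J ⊔ Ideal.span {ℓ}) g := by
  intro n hn p hp hpn
  obtain ⟨u, hu, hpu⟩ := exists_sub_mul_mem hJ hℓ hp hpn
  have hℓu : (ℓ * u).IsHomogeneous (n + 1) := by rw [add_comm]; exact hℓ.mul hu
  obtain ⟨q, hq, hpq⟩ := h n hn _ hpu (hpn.sub hℓu)
  obtain ⟨n, rfl⟩ := Nat.exists_eq_add_of_le' (hg.trans hn)
  obtain ⟨q', hq', rfl⟩ := exists_eq_sum_X_mul hu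
  refine ⟨fun a => q a + ℓ * q' a, fun a => ⟨(hq a).1.add ?_, add_mem
    (Ideal.mem_sup_left (hq a).2) (Ideal.mem_sup_right
      (Ideal.mul_mem_right _ _ (Ideal.mem_span_singleton_self _)))⟩, ?_⟩
  · rw [add_comm]; exact hℓ.mul (hq' a)
  · simp only [mul_add, Finset.sum_add_distrib]
    rw [← hpq, sub_add_eq_add_sub, eq_comm, sub_eq_iff_eq_add, Finset.mul_sum]
    congr 1
    exact Finset.sum_congr rfl fun a _ => by ring

theorem GeneratedUpTo.sectionIdeal {I : Ideal (MvPolynomial (Fin d) k)}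
    (hI : I.IsHomogeneous (homogeneousSubmodule (Fin d) k)) {ℓ : Fin d → MvPolynomial (Fin d) k}
    (hℓ : ∀ j, (ℓ j).IsHomogeneous 1) {g : ℕ} (hg : 1 ≤ g) (h : GeneratedUpTo I g) (t : ℕ) :
    GeneratedUpTo (sectionIdeal I ℓ t) g := by
  rcases le_total d t with ht | ht
  · rwa [sectionIdeal_of_le _ _ ht]
  induction ht using Nat.decreasingInduction with
  | self => rwa [sectionIdeal_of_le _ _ le_rfl]
  | of_succ t ht ih =>
    have hs := sectionIdeal_eq_sup I ℓ ⟨t, ht⟩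
    simp only at hs
    rw [hs]
    exact ih.sup (sectionIdeal_isHomogeneous hI hℓ _) (hℓ _) hg

theorem wedge_sub (c : Fin d → k) (z w : Finset (Fin d) → MvPolynomial (Fin d) k)
    (s : Finset (Fin d)) : wedge c (z - w) s = wedge c z s - wedge c w s := by
  rw [wedge_apply, wedge_apply, wedge_apply, ← Finset.sum_sub_distrib]
  refine Finset.sum_congr rfl fun b _ => ?_
  rw [wedgeVar, wedgeVar, wedgeVar]
  split_ifs
  · rw [Pi.sub_apply]; ring
  · ring

theorem wedge_single_empty (c : Fin d → k) (f : MvPolynomial (Fin d) k) (a : Fin d) :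
    wedge c (Pi.single ∅ f) {a} = C (c a) * f := by
  rw [wedge_apply, Finset.sum_eq_single a]
  · rw [wedgeVar, if_pos (Finset.mem_singleton_self a), Finset.erase_singleton,
      Pi.single_eq_same, Finset.filter_singleton, if_neg (lt_irrefl a), Finset.card_empty,
      pow_zero, one_mul]
  · intro b _ hb
    rw [wedgeVar, if_neg (by simpa using hb), mul_zero]
  · simp

/-- Persistence of nonzerodivisors (Bayer–Stillman). -/
theorem mem_of_mul_mem_succ {J : Ideal (MvPolynomial (Fin d) k)}
    (hJ : J.IsHomogeneous (homogeneousSubmodule (Fin d) k)) {c : Fin d → k} (hc : c ≠ 0) {n g : ℕ}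
    (hg : GeneratedUpTo J g) (hgn : g ≤ n + 1)
    (hcolon : ∀ p : MvPolynomial (Fin d) k, p.IsHomogeneous n → linearForm c * p ∈ J → p ∈ J)
    (hTor : TorVanish (J ⊔ Ideal.span {linearForm c}) 3 (3 + n)) {f : MvPolynomial (Fin d) k}
    (hf : f.IsHomogeneous (n + 1)) (hfJ : linearForm c * f ∈ J) : f ∈ J := by
  have hℓ := isHomogeneous_linearForm c
  have hℓf : (linearForm c * f).IsHomogeneous (n + 1 + 1) := by
    rw [add_comm (n + 1) 1]; exact hℓ.mul hf
  obtain ⟨q, hq, hq'⟩ := hg (n + 1) hgn _ hfJ hℓf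
  let F : Finset (Fin d) → MvPolynomial (Fin d) k := Pi.single ∅ f
  have hFe : F ∅ = f := Pi.single_eq_same _ _
  have hFs : ∀ s, s ≠ ∅ → F s = 0 := fun s hs => Pi.single_eq_of_ne hs _
  have hF := single_empty_mem_formChains hf
  have hDF := koszulD_eq_zero_of_mem_formChains_zero hF
  let G : Finset (Fin d) → MvPolynomial (Fin d) k := ∑ a, Pi.single {a} (q a)
  have hGa : ∀ a, G {a} = q a := by
    intro a
    simp only [G, Finset.sum_apply]
    rw [Finset.sum_eq_single a]
    · rw [Pi.single_eq_same]
    · intro b _ hb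
      exact Pi.single_eq_of_ne (fun h => hb (Finset.singleton_injective h).symm) _
    · simp
  have hG0 : ∀ s : Finset (Fin d), s.card ≠ 1 → G s = 0 := by
    intro s hs
    simp only [G, Finset.sum_apply]
    refine Finset.sum_eq_zero fun a _ => Pi.single_eq_of_ne (fun h => hs ?_) _
    rw [h, Finset.card_singleton]
  have hGJ : ∀ s, G s ∈ J ∧ (G s).IsHomogeneous (n + 1) := by
    intro s
    by_cases hs : s.card = 1
    · obtain ⟨a, rfl⟩ := Finset.card_eq_one.mp hs
      rw [hGa]; exact ⟨(hq a).2, (hq a).1⟩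
    · rw [hG0 s hs]; exact ⟨zero_mem _, isHomogeneous_zero _ _ _⟩
  have hG : G ∈ formChains k d (0 + 1) (0 + 1 + (n + 1)) :=
    mem_formChains.mpr ⟨fun s => (hGJ s).2, hG0⟩
  have hwF := wedge_mem_formChains c hF
  -- Both e ∧ F and G = ∑ q_a e_a have differential ℓf, so their difference is a cycle over R and
  -- bounds a 2-chain w with coefficients of degree n.
  have hDG : koszulD (k := k) (wedge c F - G) = 0 := by
    funext s
    have h1 := koszulD_wedge c F s
    have hw0 : wedge c (0 : Finset (Fin d) → MvPolynomial (Fin d) k) s = 0 := by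
      simp [wedge_apply, wedgeVar]
    rw [hDF, hw0, add_zero] at h1
    rw [map_sub, Pi.sub_apply, h1, Pi.zero_apply, sub_eq_zero]
    by_cases hs : s = ∅
    · subst hs
      rw [koszulD_apply_empty, hFe, hq']
      exact Finset.sum_congr rfl fun a _ => by rw [hGa]
    · rw [hFs s hs, mul_zero, eq_comm]
      refine (mem_formChains.mp (koszulD_mem_formChains hG)).2 s ?_
      rwa [Ne, Finset.card_eq_zero]
  obtain ⟨w, hw, hDw⟩ := exists_koszulD_eq (Or.inr (Nat.succ_ne_zero 0)) (sub_mem hwF hG) hDG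
  rw [show 0 + 1 + (n + 1) = 0 + 1 + 1 + n by ring] at hw
  have hDww : ∀ s, koszulD (k := k) (wedge c w) s = linearForm c * w s + wedge c G s := by
    intro s
    have h1 := koszulD_wedge c w s
    rw [hDw, wedge_sub, wedge_wedge, Pi.zero_apply, zero_sub] at h1
    linear_combination h1
  have hww := wedge_mem_formChains c hw
  -- Since e ∧ e = 0, D(e ∧ w) = ℓw + e ∧ G, which vanishes modulo J + (ℓ). The remaining
  -- cancellation of ℓ is as in `TorVanish.of_sup`.
  obtain ⟨v, hv, hv'⟩ := hTor (wedge c w) hww (fun s => by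
    rw [hDww]
    exact add_mem (Ideal.mem_sup_right (Ideal.mul_mem_right _ _ (Ideal.mem_span_singleton_self _)))
      (Ideal.mem_sup_left (wedge_mem c (fun s => (hGJ s).1) s)))
  have hdiff : wedge c w - koszulD (k := k) v ∈ formChains k d 3 (2 + n + 1) := by
    have := sub_mem hww (koszulD_mem_formChains' hv)
    rwa [show 2 + n + 1 = 3 + n by ring]
  obtain ⟨u, hu, hu'⟩ := exists_chain_sub_mul_mem hJ hℓ hdiff hv'
  have hwu : ∀ s, w s - koszulD (k := k) u s ∈ J := by
    intro s
    refine hcolon _ ((mem_formChains.mp (sub_mem hw (koszulD_mem_formChains' hu))).1 s) ?_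
    have h1 : koszulD (k := k) (wedge c w - koszulD (k := k) v - linearForm c • u) s ∈ J :=
      koszulD_mem hu' s
    rw [map_sub, koszulD_sub_koszulD, map_smul, Pi.sub_apply, hDww] at h1
    have h2 := sub_mem h1 (wedge_mem c (fun s => (hGJ s).1) s)
    rw [Pi.smul_apply, smul_eq_mul] at h2
    convert h2 using 1
    ring
  have hyJ : ∀ s, wedge c F s - G s ∈ J := by
    intro s
    have : koszulD (k := k) (w - koszulD (k := k) u) s ∈ J := koszulD_mem hwu s
    rw [koszulD_sub_koszulD, hDw] at this
    exact this
  -- The coefficient of e ∧ F at e_a is c_a f, so one nonzero c_a suffices.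
  obtain ⟨a, ha⟩ := Function.ne_iff.mp hc
  have h1 := add_mem (hyJ {a}) (hGJ {a}).1
  rw [sub_add_cancel, wedge_single_empty] at h1
  have h2 := Ideal.mul_mem_left J (C (c a)⁻¹) h1
  rwa [← mul_assoc, ← map_mul, inv_mul_cancel₀ ha, map_one, one_mul] at h2

theorem row_ne_zero (γ : Matrix.GeneralLinearGroup (Fin d) k) (i : Fin d) :
    (γ : Matrix (Fin d) (Fin d) k) i ≠ 0 := by
  intro h
  have hu : IsUnit (γ : Matrix (Fin d) (Fin d) k).det := (Matrix.isUnit_iff_isUnit_det _).mp γ.isUnit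
  rw [Matrix.det_eq_zero_of_row_eq_zero i (fun j => congrFun h j)] at hu
  exact not_isUnit_zero hu

/-- All t must advance together: the vanishing of Tor_3 used at t comes from the absence of defects
in the same degree at all s < t. -/
theorem not_colonDefect_of_le {I : Ideal (MvPolynomial (Fin d) k)}
    (hI : I.IsHomogeneous (homogeneousSubmodule (Fin d) k))
    (γ : Matrix.GeneralLinearGroup (Fin d) k) {g n : ℕ} (hg : GeneratedUpTo I g) (hg1 : 1 ≤ g)
    (hgn : g ≤ n) (hE : ∀ t, ¬ ColonDefect I (linForm γ) t n) {m : ℕ} (hm : n ≤ m) (t : Fin d) :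
    ¬ ColonDefect I (linForm γ) t m := by
  induction m, hm using Nat.le_induction generalizing t with
  | base => exact hE t
  | succ m hnm ih =>
    rintro ⟨f, hf, hfm, hfJ⟩
    refine hfJ (mem_of_mul_mem_succ (sectionIdeal_isHomogeneous hI (isHomogeneous_linForm γ) _)
      (row_ne_zero γ t) (hg.sectionIdeal hI (isHomogeneous_linForm γ) hg1 _) (by omega)
      (fun p hp => mem_of_not_colonDefect (ih t) hp) ?_ hf hfm)
    have := torVanish_sectionIdeal hI (γ : Matrix (Fin d) (Fin d) k)
      (idealOfVars_le_sectionIdeal γ I) m t t.2.le (fun s _ => ih s) 3 (Or.inl (by omega))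
    change TorVanish (SectReg.sectionIdeal I (linForm γ) t) 3 (3 + m) at this
    rwa [sectionIdeal_eq_sup] at this

end Persistence

/-! ### Existence of almost regular coordinates over an infinite field -/

section GenericForms

variable {k : Type*} [Field k] {d : ℕ}

theorem mem_colon_pow {J : Ideal (MvPolynomial (Fin d) k)} {N : ℕ} {p : MvPolynomial (Fin d) k} :
    p ∈ J.colon ((idealOfVars (Fin d) k ^ N : Ideal (MvPolynomial (Fin d) k)) :
      Set (MvPolynomial (Fin d) k)) ↔ ∀ q ∈ idealOfVars (Fin d) k ^ N, q * p ∈ J := by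
  simp only [Submodule.mem_colon, SetLike.mem_coe, smul_eq_mul, mul_comm p]

theorem colon_pow_isHomogeneous {J : Ideal (MvPolynomial (Fin d) k)}
    (hJ : J.IsHomogeneous (homogeneousSubmodule (Fin d) k)) (N : ℕ) :
    (J.colon ((idealOfVars (Fin d) k ^ N : Ideal (MvPolynomial (Fin d) k)) :
      Set (MvPolynomial (Fin d) k))).IsHomogeneous (homogeneousSubmodule (Fin d) k) := by
  refine isHomogeneous_of_component_mem fun p hp n => ?_
  rw [mem_colon_pow] at hp ⊢
  intro q hq
  rw [pow_idealOfVars_eq_span] at hq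
  refine Submodule.span_induction (p := fun q _ => q * homogeneousComponent n p ∈ J)
    ?_ ?_ ?_ ?_ hq
  · rintro _ ⟨x, hx, rfl⟩
    have hx' : (monomial x (1 : k)).IsHomogeneous N := isHomogeneous_monomial _ hx
    change monomial x (1 : k) * homogeneousComponent n p ∈ J
    rw [← homogeneousComponent_mul_add hx']
    refine component_mem hJ (hp _ ?_) _
    rw [monomial_mem_pow_idealOfVars_iff _ _ one_ne_zero]
    exact le_of_eq hx.symm
  · rw [zero_mul]; exact zero_mem _
  · intro a b _ _ ha hb
    rw [add_mul]; exact add_mem ha hb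
  · intro a b _ hb
    rw [smul_eq_mul, mul_assoc]; exact Ideal.mul_mem_left _ _ hb

theorem GeneratedUpTo.mem_pow_mul {K : Ideal (MvPolynomial (Fin d) k)} {g : ℕ}
    (hg : GeneratedUpTo K g) (m : ℕ) {p : MvPolynomial (Fin d) k} (hp : p ∈ K)
    (hpm : p.IsHomogeneous (g + m)) : p ∈ idealOfVars (Fin d) k ^ m * K := by
  induction m generalizing p with
  | zero => simpa using hp
  | succ m ih =>
    obtain ⟨q, hq, rfl⟩ := hg (g + m) (Nat.le_add_right _ _) p hp hpm
    refine Ideal.sum_mem _ fun a _ => ?_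
    rw [pow_succ', mul_assoc]
    exact Ideal.mul_mem_mul (Ideal.subset_span ⟨a, rfl⟩) (ih (hq a).2 (hq a).1)

/-- The linear map sending coefficients to the corresponding linear form. -/
noncomputable def linearFormHom (k : Type*) [Field k] (d : ℕ) :
    (Fin d → k) →ₗ[k] MvPolynomial (Fin d) k where
  toFun := linearForm
  map_add' c c' := by
    simp only [linearForm, Pi.add_apply, map_add, add_mul, Finset.sum_add_distrib]
  map_smul' r c := by
    simp only [linearForm, Pi.smul_apply, smul_eq_mul, map_mul, RingHom.id_apply, smul_eq_C_mul,
      Finset.mul_sum, mul_assoc]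

/-- Linear forms outside finitely many proper subspaces are nonzerodivisors in large degrees. -/
theorem exists_finset_subspace {J : Ideal (MvPolynomial (Fin d) k)}
    (hJ : J.IsHomogeneous (homogeneousSubmodule (Fin d) k)) :
    ∃ s : Finset (Subspace k (Fin d → k)), ⊤ ∉ s ∧ ∀ c : Fin d → k, (∀ W ∈ s, c ∉ W) →
      ∃ N, ∀ n, N ≤ n → ∀ p : MvPolynomial (Fin d) k, p.IsHomogeneous n →
        linearForm c * p ∈ J → p ∈ J := by
  classical
  let K : ℕ →o Ideal (MvPolynomial (Fin d) k) :=
    { toFun := fun N => J.colon ((idealOfVars (Fin d) k ^ N : Ideal (MvPolynomial (Fin d) k)) :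
        Set (MvPolynomial (Fin d) k))
      monotone' := fun N N' h p hp => by
        rw [mem_colon_pow] at hp ⊢
        exact fun q hq => hp q (Ideal.pow_le_pow_right h hq) }
  -- The stable value K N is the saturation of J with respect to 𝔪.
  obtain ⟨N, hN⟩ := monotone_stabilizes_iff_noetherian.mpr
    (inferInstance : IsNoetherianRing (MvPolynomial (Fin d) k)) K
  have hK : ∀ p, p ∈ K N ↔ ∀ q ∈ idealOfVars (Fin d) k ^ N, q * p ∈ J := fun p => mem_colon_pow
  have hsat : ∀ p, (∀ q ∈ idealOfVars (Fin d) k, q * p ∈ K N) → p ∈ K N := by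
    intro p hp
    rw [hN (N + 1) (Nat.le_succ N)]
    refine mem_colon_pow.mpr fun q hq => ?_
    rw [pow_succ] at hq
    refine Submodule.mul_induction_on hq (fun a ha b hb => ?_) fun a b ha hb => ?_
    · rw [mul_assoc]
      exact (hK _).mp (hp b hb) a ha
    · rw [add_mul]; exact add_mem ha hb
  have hfin := associatedPrimes.finite (MvPolynomial (Fin d) k) (MvPolynomial (Fin d) k ⧸ K N)
  refine ⟨hfin.toFinset.image fun P => (P.restrictScalars k).comap (linearFormHom k d), ?_, ?_⟩
  · intro htop
    obtain ⟨P, hP, hPtop⟩ := Finset.mem_image.mp htop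
    rw [Set.Finite.mem_toFinset, AssociatedPrimes.mem_iff, isAssociatedPrime_iff] at hP
    obtain ⟨hprime, x, rfl⟩ := hP
    obtain ⟨p, rfl⟩ := Ideal.Quotient.mk_surjective x
    have hX : ∀ q, q ∈ (⊥ : Submodule (MvPolynomial (Fin d) k) (MvPolynomial (Fin d) k ⧸ K N)).colon
        {Ideal.Quotient.mk (K N) p} ↔ q * p ∈ K N := by
      intro q
      rw [Submodule.mem_colon_singleton, Submodule.mem_bot, ← Ideal.Quotient.eq_zero_iff_mem,
        map_mul]
      rfl
    -- An associated prime containing all variables would make p a socle element modulo K N;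
    -- saturation forces p ∈ K N.
    refine hprime.ne_top ((Ideal.eq_top_iff_one _).mpr ?_)
    rw [hX, one_mul]
    refine hsat p fun q hq => (hX q).mp ?_
    refine (Ideal.span_le.mpr ?_) hq
    rintro _ ⟨j, rfl⟩
    have : (Pi.single j (1 : k)) ∈ (⊤ : Subspace k (Fin d → k)) := trivial
    rw [← hPtop] at this
    have h2 : linearForm (Pi.single j (1 : k)) ∈
      (⊥ : Submodule (MvPolynomial (Fin d) k) (MvPolynomial (Fin d) k ⧸ K N)).colon
        {Ideal.Quotient.mk (K N) p} := this
    rwa [linearForm_single] at h2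
  · intro c hc
    obtain ⟨g, hg⟩ := exists_generatedUpTo (colon_pow_isHomogeneous hJ N)
    refine ⟨g + N, fun n hn p hp hm => ?_⟩
    have hle : J ≤ K N := fun q hq => (hK q).mpr fun r _ => Ideal.mul_mem_left _ _ hq
    have hpK : p ∈ K N := by
      by_contra hpK
      have hz : linearForm c ∈ {r : MvPolynomial (Fin d) k |
          ∃ x : MvPolynomial (Fin d) k ⧸ K N, x ≠ 0 ∧ r • x = 0} := by
        refine ⟨Ideal.Quotient.mk (K N) p, fun h => hpK (Ideal.Quotient.eq_zero_iff_mem.mp h), ?_⟩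
        exact Ideal.Quotient.eq_zero_iff_mem.mpr (hle hm)
      rw [← biUnion_associatedPrimes_eq_zero_divisors] at hz
      obtain ⟨P, hP, hcP⟩ := Set.mem_iUnion₂.mp hz
      exact hc _ (Finset.mem_image.mpr ⟨P, hfin.mem_toFinset.mpr hP, rfl⟩) hcP
    obtain ⟨e, rfl⟩ := Nat.exists_eq_add_of_le hn
    rw [add_assoc] at hp
    -- In degrees at least g + N the ideal K N lies in 𝔪^N · K N, hence in J.
    have h1 := Ideal.mul_mono_left (Ideal.pow_le_pow_right (Nat.le_add_right N e))
      (hg.mem_pow_mul (N + e) hpK hp)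
    refine Submodule.mul_induction_on h1 (fun a ha b hb => ?_) fun a b ha hb => add_mem ha hb
    exact (hK b).mp hb a ha

/-- Forms are chosen from the last index downwards. Each avoids finitely many proper subspaces: the
bad ones for almost regularity, and the span of the forms already chosen. -/
theorem exists_almostRegular_family [Infinite k] {I : Ideal (MvPolynomial (Fin d) k)}
    (hI : I.IsHomogeneous (homogeneousSubmodule (Fin d) k)) (t : ℕ) (ht : t ≤ d) :
    ∃ c : Fin d → Fin d → k, LinearIndepOn k c {j : Fin d | t ≤ (j : ℕ)} ∧
      ∀ s : Fin d, t ≤ (s : ℕ) → ∃ N, ∀ n, N ≤ n →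
        ¬ ColonDefect I (fun j => linearForm (c j)) s n := by
  classical
  induction ht using Nat.decreasingInduction with
  | self =>
    refine ⟨0, ?_, fun s hs => absurd hs (by omega)⟩
    have : {j : Fin d | d ≤ (j : ℕ)} = ∅ := by
      ext j
      simp only [Set.mem_ofPred_eq, Set.mem_empty_iff_false, iff_false]
      omega
    rw [this]
    exact linearIndepOn_empty _ _
  | of_succ t ht ih =>
    obtain ⟨c, hc, hE⟩ := ih
    let t' : Fin d := ⟨t, ht⟩
    obtain ⟨S, hS, hSc⟩ := exists_finset_subspace (sectionIdeal_isHomogeneous hI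
      (fun j => isHomogeneous_linearForm (c j)) (t + 1))
    let T : Finset (Fin d) := Finset.univ.filter fun j : Fin d => t + 1 ≤ (j : ℕ)
    have hT : c '' {j : Fin d | t + 1 ≤ (j : ℕ)} = (T.image c : Finset (Fin d → k)) := by
      ext v; simp [T]
    let W : Subspace k (Fin d → k) := Submodule.span k (c '' {j : Fin d | t + 1 ≤ (j : ℕ)})
    have hW : W ≠ ⊤ := by
      intro h
      have h1 : Module.finrank k W ≤ (T.image c).card := by
        have := finrank_span_finset_le_card (R := k) (T.image c)
        rw [← hT] at this
        exact this
      rw [h, finrank_top, Module.finrank_fin_fun] at h1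
      have h2 : T.card < d := by
        have : T ⊂ Finset.univ := by
          refine Finset.ssubset_univ_iff.mpr fun h => ?_
          have : t' ∈ T := h ▸ Finset.mem_univ _
          simp [T, t'] at this
        simpa using Finset.card_lt_card this
      exact absurd (h1.trans Finset.card_image_le) (not_le.mpr h2)
    obtain ⟨v, hv⟩ := (Set.ne_univ_iff_exists_notMem _).mp
      (Subspace.biUnion_ne_univ_of_top_notMem (s := insert W S)
        (fun h => (Finset.mem_insert.mp h).elim (fun h => hW h.symm) hS))
    have hvW : ∀ U ∈ insert W S, v ∉ U := fun U hU hvU => hv (Set.mem_iUnion₂.mpr ⟨U, hU, hvU⟩)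
    have hup : ∀ j : Fin d, t + 1 ≤ (j : ℕ) → Function.update c t' v j = c j := fun j hj =>
      Function.update_of_ne (fun h => by rw [h] at hj; exact absurd hj (by simp [t'])) _ _
    have hset : {j : Fin d | t ≤ (j : ℕ)} = insert t' {j : Fin d | t + 1 ≤ (j : ℕ)} := by
      ext j
      simp only [Set.mem_ofPred_eq, Set.mem_insert_iff, Fin.ext_iff, t']
      omega
    have hideal : ∀ u, t + 1 ≤ u →
        sectionIdeal I (fun j => linearForm (Function.update c t' v j)) u =
          sectionIdeal I (fun j => linearForm (c j)) u := fun u hu =>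
      sectionIdeal_congr fun j hj => by rw [hup j (hu.trans hj)]
    refine ⟨Function.update c t' v, ?_, fun s hs => ?_⟩
    · rw [hset]
      refine LinearIndepOn.insert (hc.congr fun j hj => (hup j hj).symm) ?_
      have himage : Function.update c t' v '' {j : Fin d | t + 1 ≤ (j : ℕ)} =
          c '' {j : Fin d | t + 1 ≤ (j : ℕ)} := Set.image_congr fun j hj => hup j hj
      rw [Function.update_self, himage]
      exact hvW W (Finset.mem_insert_self _ _)
    · rcases eq_or_lt_of_le hs with h | h
      · obtain rfl : s = t' := Fin.ext h.symm
        obtain ⟨N, hN⟩ := hSc v fun U hU => hvW U (Finset.mem_insert_of_mem hU)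
        refine ⟨N, fun n hn => ?_⟩
        rintro ⟨p, hp, hm, hpJ⟩
        simp only [Function.update_self] at hm
        rw [hideal _ le_rfl] at hm hpJ
        exact hpJ (hN n hn p hp hm)
      · obtain ⟨N, hN⟩ := hE s h
        refine ⟨N, fun n hn => ?_⟩
        rintro ⟨p, hp, hm, hpJ⟩
        simp only [hup s h] at hm
        rw [hideal _ (by omega)] at hm hpJ
        exact hN n hn ⟨p, hp, hm, hpJ⟩

/-- Over an infinite field some coordinates are almost regular. -/
theorem exists_isAlmostRegular [Infinite k] {I : Ideal (MvPolynomial (Fin d) k)}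
    (hI : I.IsHomogeneous (homogeneousSubmodule (Fin d) k)) :
    ∃ γ : Matrix.GeneralLinearGroup (Fin d) k, IsAlmostRegular I (linForm γ) := by
  obtain ⟨c, hc, hE⟩ := exists_almostRegular_family hI 0 (Nat.zero_le d)
  have huniv : {j : Fin d | 0 ≤ (j : ℕ)} = Set.univ := by
    ext j; simp
  rw [huniv, linearIndepOn_univ_iff] at hc
  obtain ⟨γ, hγ⟩ := (Matrix.linearIndependent_rows_iff_isUnit (A := Matrix.of c)).mp hc
  have hγ' : linForm γ = fun j => linearForm (c j) := by
    funext j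
    rw [linForm_eq, hγ]
    rfl
  refine ⟨γ, (isAlmostRegular_iff hI (isHomogeneous_linForm γ)).mpr fun t => ?_⟩
  rw [hγ']
  exact hE t (Nat.zero_le _)

end GenericForms

/-! ### Hilbert functions of section ideals and semicontinuity -/

section HilbertFunctions

variable {k : Type*} [Field k] {d : ℕ}

/-- The component of degree `n` of an ideal. -/
noncomputable def idealComponent (J : Ideal (MvPolynomial (Fin d) k)) (n : ℕ) :
    Submodule k (MvPolynomial (Fin d) k) :=
  J.restrictScalars k ⊓ homogeneousSubmodule (Fin d) k n

theorem mem_idealComponent {J : Ideal (MvPolynomial (Fin d) k)} {n : ℕ}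
    {p : MvPolynomial (Fin d) k} : p ∈ idealComponent J n ↔ p ∈ J ∧ p.IsHomogeneous n := Iff.rfl

instance finite_of_le_homogeneousSubmodule (n : ℕ)
    (V : Submodule k (MvPolynomial (Fin d) k)) :
    Module.Finite k (V ⊓ homogeneousSubmodule (Fin d) k n : Submodule k _) :=
  Submodule.finiteDimensional_of_le inf_le_right

instance finite_idealComponent (J : Ideal (MvPolynomial (Fin d) k)) (n : ℕ) :
    Module.Finite k (idealComponent J n) := finite_of_le_homogeneousSubmodule n _

/-- The Hilbert function of an ideal. -/
noncomputable def hilb (J : Ideal (MvPolynomial (Fin d) k)) (n : ℕ) : ℕ :=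
  Module.finrank k (idealComponent J n)

theorem hilb_le (J : Ideal (MvPolynomial (Fin d) k)) (n : ℕ) :
    hilb J n ≤ Module.finrank k (homogeneousSubmodule (Fin d) k n) :=
  Submodule.finrank_mono inf_le_right

/-- The forms of degree `n` that are multiplied into `J` by `ℓ`. -/
noncomputable def colonComponent (J : Ideal (MvPolynomial (Fin d) k)) (ℓ : MvPolynomial (Fin d) k)
    (n : ℕ) : Submodule k (MvPolynomial (Fin d) k) :=
  (J.restrictScalars k).comap (LinearMap.mulLeft k ℓ) ⊓ homogeneousSubmodule (Fin d) k n

theorem mem_colonComponent {J : Ideal (MvPolynomial (Fin d) k)} {ℓ : MvPolynomial (Fin d) k}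
    {n : ℕ} {p : MvPolynomial (Fin d) k} :
    p ∈ colonComponent J ℓ n ↔ ℓ * p ∈ J ∧ p.IsHomogeneous n := Iff.rfl

instance finite_colonComponent (J : Ideal (MvPolynomial (Fin d) k)) (ℓ : MvPolynomial (Fin d) k)
    (n : ℕ) : Module.Finite k (colonComponent J ℓ n) := finite_of_le_homogeneousSubmodule n _

/-- The dimension formula for the subspaces J_{n+1} and ℓR_n: their sum is the component of J + (ℓ),
their intersection is ℓ times the colon component. -/
theorem hilb_sup_add_finrank {J : Ideal (MvPolynomial (Fin d) k)}
    (hJ : J.IsHomogeneous (homogeneousSubmodule (Fin d) k)) {ℓ : MvPolynomial (Fin d) k}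
    (hℓ : ℓ.IsHomogeneous 1) (hℓ0 : ℓ ≠ 0) (n : ℕ) :
    hilb (J ⊔ Ideal.span {ℓ}) (n + 1) + Module.finrank k (colonComponent J ℓ n) =
      hilb J (n + 1) + Module.finrank k (homogeneousSubmodule (Fin d) k n) := by
  have hinj : Function.Injective (LinearMap.mulLeft k ℓ) := fun p q h => mul_left_cancel₀ hℓ0 h
  have hmap : ∀ V : Submodule k (MvPolynomial (Fin d) k),
      Module.finrank k (V.map (LinearMap.mulLeft k ℓ)) = Module.finrank k V :=
    fun V => (Submodule.equivMapOfInjective _ hinj V).finrank_eq.symm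
  have hB := Submodule.finrank_sup_add_finrank_inf_eq (idealComponent J (n + 1))
    ((homogeneousSubmodule (Fin d) k n).map (LinearMap.mulLeft k ℓ))
  have hsup : idealComponent J (n + 1) ⊔
      (homogeneousSubmodule (Fin d) k n).map (LinearMap.mulLeft k ℓ) =
      idealComponent (J ⊔ Ideal.span {ℓ}) (n + 1) := by
    refine le_antisymm (sup_le ?_ ?_) ?_
    · exact fun p hp => ⟨Ideal.mem_sup_left hp.1, hp.2⟩
    · rintro _ ⟨p, hp, rfl⟩
      refine mem_idealComponent.mpr ⟨Ideal.mem_sup_right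
        (Ideal.mul_mem_right _ _ (Ideal.mem_span_singleton_self _)), ?_⟩
      rw [add_comm]; exact hℓ.mul hp
    · intro p hp
      obtain ⟨hp1, hp2⟩ := mem_idealComponent.mp hp
      obtain ⟨u, hu, hpu⟩ := exists_sub_mul_mem hJ hℓ hp1 hp2
      refine Submodule.mem_sup.mpr ⟨p - ℓ * u, mem_idealComponent.mpr ⟨hpu, hp2.sub ?_⟩,
        ℓ * u, ⟨u, hu, rfl⟩, sub_add_cancel _ _⟩
      rw [add_comm]; exact hℓ.mul hu
  have hinf : idealComponent J (n + 1) ⊓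
      (homogeneousSubmodule (Fin d) k n).map (LinearMap.mulLeft k ℓ) =
      (colonComponent J ℓ n).map (LinearMap.mulLeft k ℓ) := by
    ext p
    constructor
    · rintro ⟨hp, u, hu, rfl⟩
      exact ⟨u, mem_colonComponent.mpr ⟨hp.1, hu⟩, rfl⟩
    · rintro ⟨u, hu, rfl⟩
      obtain ⟨hu1, hu2⟩ := mem_colonComponent.mp hu
      refine ⟨mem_idealComponent.mpr ⟨hu1, ?_⟩, u, hu2, rfl⟩
      rw [add_comm]; exact hℓ.mul hu2
  rwa [hsup, hinf, hmap, hmap] at hB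

theorem linForm_ne_zero (γ : Matrix.GeneralLinearGroup (Fin d) k) (t : Fin d) :
    linForm γ t ≠ 0 := fun h =>
  linForm_notMem_sectionIdeal_bot γ (Nat.lt_succ_self t) (h ▸ zero_mem _)

/-- The slack is the dimension of the kernel of ℓ_t on degree n of R/J_{t+1}, so equality
characterises the absence of defects. -/
theorem hilb_sectionIdeal_le {I : Ideal (MvPolynomial (Fin d) k)}
    (hI : I.IsHomogeneous (homogeneousSubmodule (Fin d) k))
    (γ : Matrix.GeneralLinearGroup (Fin d) k) (t : Fin d) (n : ℕ) :
    hilb (sectionIdeal I (linForm γ) t) (n + 1) + hilb (sectionIdeal I (linForm γ) (t + 1)) n ≤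
      hilb (sectionIdeal I (linForm γ) (t + 1)) (n + 1) +
        Module.finrank k (homogeneousSubmodule (Fin d) k n) := by
  rw [sectionIdeal_eq_sup I _ t, ← hilb_sup_add_finrank
    (sectionIdeal_isHomogeneous hI (isHomogeneous_linForm γ) _) (isHomogeneous_linForm γ t)
    (linForm_ne_zero γ t)]
  refine Nat.add_le_add_left (Submodule.finrank_mono fun p hp => ?_) _
  exact mem_colonComponent.mpr ⟨Ideal.mul_mem_left _ _ hp.1, hp.2⟩

theorem not_colonDefect_iff {I : Ideal (MvPolynomial (Fin d) k)}
    (hI : I.IsHomogeneous (homogeneousSubmodule (Fin d) k))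
    (γ : Matrix.GeneralLinearGroup (Fin d) k) (t : Fin d) (n : ℕ) :
    ¬ ColonDefect I (linForm γ) t n ↔
    hilb (sectionIdeal I (linForm γ) t) (n + 1) + hilb (sectionIdeal I (linForm γ) (t + 1)) n =
      hilb (sectionIdeal I (linForm γ) (t + 1)) (n + 1) +
        Module.finrank k (homogeneousSubmodule (Fin d) k n) := by
  rw [sectionIdeal_eq_sup I _ t, ← hilb_sup_add_finrank
    (sectionIdeal_isHomogeneous hI (isHomogeneous_linForm γ) _) (isHomogeneous_linForm γ t)
    (linForm_ne_zero γ t), Nat.add_left_cancel_iff]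
  have hle : idealComponent (sectionIdeal I (linForm γ) (t + 1)) n ≤
      colonComponent (sectionIdeal I (linForm γ) (t + 1)) (linForm γ t) n :=
    fun p hp => mem_colonComponent.mpr ⟨Ideal.mul_mem_left _ _ hp.1, hp.2⟩
  constructor
  · intro h
    refine congrArg (fun V : Submodule k (MvPolynomial (Fin d) k) => Module.finrank k V)
      (le_antisymm hle fun p hp => ?_)
    obtain ⟨hp1, hp2⟩ := mem_colonComponent.mp hp
    exact ⟨mem_of_not_colonDefect h hp2 hp1, hp2⟩
  · rintro h ⟨p, hp, hm, hc⟩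
    have heq := Submodule.eq_of_le_of_finrank_eq hle h
    have : p ∈ colonComponent (sectionIdeal I (linForm γ) (t + 1)) (linForm γ t) n :=
      mem_colonComponent.mpr ⟨hm, hp⟩
    rw [← heq] at this
    exact hc this.1

/-- Lower semicontinuity of the Hilbert functions of the section ideals. -/
theorem exists_polynomial_hilb_le {I : Ideal (MvPolynomial (Fin d) k)}
    (hI : I.IsHomogeneous (homogeneousSubmodule (Fin d) k))
    (γ₀ : Matrix.GeneralLinearGroup (Fin d) k) (t n : ℕ) :
    ∃ f : MvPolynomial (Fin d × Fin d) k, f ≠ 0 ∧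
      ∀ γ : Matrix.GeneralLinearGroup (Fin d) k,
        eval (fun p => (γ : Matrix (Fin d) (Fin d) k) p.1 p.2) f ≠ 0 →
        hilb (sectionIdeal I (linForm γ₀) t) n ≤ hilb (sectionIdeal I (linForm γ) t) n := by
  have hmem : ∀ q : idealComponent (sectionIdeal I (linForm γ₀) t) n,
      ∃ a ∈ I, ∃ c : Fin d → MvPolynomial (Fin d) k, (∀ j : Fin d, ¬ t ≤ (j : ℕ) → c j = 0) ∧
        (q : MvPolynomial (Fin d) k) = a + ∑ j, c j * linForm γ₀ j := by
    rintro ⟨q, hq, -⟩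
    obtain ⟨a, ha, b, hb, rfl⟩ := Submodule.mem_sup.mp hq
    have hb' : b ∈ Ideal.span (Set.range fun j : Fin d => if t ≤ (j : ℕ) then linForm γ₀ j else 0) := by
      refine Ideal.span_mono ?_ hb
      rintro _ ⟨j, hj, rfl⟩
      exact ⟨j, if_pos hj⟩
    obtain ⟨c, rfl⟩ := Ideal.mem_span_range_iff_exists_fun.mp hb'
    refine ⟨a, ha, fun j => if t ≤ (j : ℕ) then c j else 0, fun j hj => if_neg hj, ?_⟩
    refine congrArg (a + ·) (Finset.sum_congr rfl fun j _ => ?_)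
    by_cases h : t ≤ (j : ℕ)
    · simp only [if_pos h]
    · simp only [if_neg h, mul_zero, zero_mul]
  choose a ha c hc hac using hmem
  let b := Module.finBasis k (idealComponent (sectionIdeal I (linForm γ₀) t) n)
  obtain ⟨Φ, hΦ⟩ := LinearMap.exists_leftInverse_of_injective
    (idealComponent (sectionIdeal I (linForm γ₀) t) n).subtype (Submodule.ker_subtype _)
  -- The component of degree n is taken because a and the cofactors c need not be homogeneous; Φ
  -- projects onto the component at γ₀.
  let θ : MvPolynomial (Fin d) k →ₗ[k] (Fin _ → k) :=
    b.equivFun.toLinearMap ∘ₗ Φ ∘ₗ homogeneousComponent n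
  -- The basis elements at γ₀ are deformed: a and c stay fixed and only the linear forms vary, so
  -- the matrix A has entries of degree at most 1 in the entries of γ.
  let v : Matrix.GeneralLinearGroup (Fin d) k → Fin _ → MvPolynomial (Fin d) k :=
    fun γ q => a (b q) + ∑ j, c (b q) j * linForm γ j
  have hv : ∀ γ q, v γ q ∈ sectionIdeal I (linForm γ) t := by
    refine fun γ q => add_mem (Ideal.mem_sup_left (ha _)) (Ideal.sum_mem _ fun j _ => ?_)
    by_cases hj : t ≤ (j : ℕ)
    · exact Ideal.mul_mem_left _ _ (mem_sectionIdeal hj)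
    · rw [hc _ j hj, zero_mul]; exact zero_mem _
  let A : Matrix (Fin _) (Fin _) (MvPolynomial (Fin d × Fin d) k) := Matrix.of fun p q =>
    C (θ (a (b q)) p) + ∑ j, ∑ l, C (θ (X l * c (b q) j) p) * X (j, l)
  have hA : ∀ γ : Matrix.GeneralLinearGroup (Fin d) k,
      (eval fun p => (γ : Matrix (Fin d) (Fin d) k) p.1 p.2).mapMatrix A =
        Matrix.of fun p q => θ (v γ q) p := by
    intro γ
    ext p q
    simp only [RingHom.mapMatrix_apply, Matrix.map_apply, Matrix.of_apply, A, v, map_add, map_sum,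
      map_mul, eval_C, eval_X, Pi.add_apply, Finset.sum_apply]
    refine congrArg (_ + ·) (Finset.sum_congr rfl fun j _ => ?_)
    rw [linForm, Finset.mul_sum, map_sum, Finset.sum_apply]
    refine Finset.sum_congr rfl fun l _ => ?_
    rw [show c (b q) j * (C ((γ : Matrix (Fin d) (Fin d) k) j l) * X l) =
      (γ : Matrix (Fin d) (Fin d) k) j l • (X l * c (b q) j) by rw [smul_eq_C_mul]; ring,
      map_smul, Pi.smul_apply, smul_eq_mul, mul_comm]
  refine ⟨A.det, fun h0 => ?_, fun γ hγ => ?_⟩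
  · have h1 := congrArg (eval fun p => (γ₀ : Matrix (Fin d) (Fin d) k) p.1 p.2) h0
    rw [RingHom.map_det, hA, map_zero] at h1
    -- At γ₀ the deformation is trivial, so the determinant is not the zero polynomial.
    have : (Matrix.of fun p q => θ (v γ₀ q) p) = 1 := by
      ext p q
      have h2 : v γ₀ q = b q := (hac (b q)).symm
      have h3 : Φ (b q : MvPolynomial (Fin d) k) = b q := DFunLike.congr_fun hΦ (b q)
      rw [Matrix.of_apply, h2]
      simp only [θ, LinearMap.comp_apply]
      rw [homogeneousComponent_of_isHomogeneous (b q).2.2, h3]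
      simp [Matrix.one_apply, eq_comm]
    rw [this, Matrix.det_one] at h1
    exact one_ne_zero h1
  · rw [RingHom.map_det, hA] at hγ
    have hunit := (Matrix.isUnit_iff_isUnit_det _).mpr (isUnit_iff_ne_zero.mpr hγ)
    have hcols := Matrix.linearIndependent_cols_iff_isUnit.mpr hunit
    let w : Fin _ → idealComponent (sectionIdeal I (linForm γ) t) n := fun q =>
      ⟨homogeneousComponent n (v γ q), component_mem (sectionIdeal_isHomogeneous hI
        (isHomogeneous_linForm γ) t) (hv γ q) n, homogeneousComponent_isHomogeneous n _⟩
    have hw : LinearIndependent k w := by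
      refine LinearIndependent.of_comp (b.equivFun.toLinearMap ∘ₗ Φ ∘ₗ
        (idealComponent (sectionIdeal I (linForm γ) t) n).subtype) ?_
      exact hcols
    have := hw.fintype_card_le_finrank
    rwa [Fintype.card_fin] at this

end HilbertFunctions

/-! ### Nonempty open sets and constancy of the defects -/

section GenericCoordinates

variable {k : Type*} [Field k] {d : ℕ}

theorem exists_generalLinearGroup_eval_ne_zero [Infinite k] {f : MvPolynomial (Fin d × Fin d) k}
    (hf : f ≠ 0) : ∃ γ : Matrix.GeneralLinearGroup (Fin d) k,
      eval (fun p => (γ : Matrix (Fin d) (Fin d) k) p.1 p.2) f ≠ 0 := by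
  have hdet := Matrix.det_mvPolynomialX_ne_zero (Fin d) k
  have hne := mul_ne_zero hf hdet
  obtain ⟨x, hx⟩ : ∃ x, eval x (f * (Matrix.mvPolynomialX (Fin d) (Fin d) k).det) ≠ 0 := by
    by_contra! h
    exact hne (MvPolynomial.funext fun x => by rw [h x, map_zero])
  rw [map_mul] at hx
  have hA : (Matrix.of fun i j => x (i, j)).det ≠ 0 := by
    have h := right_ne_zero_of_mul hx
    rw [RingHom.map_det] at h
    rwa [← Matrix.mvPolynomialX_mapMatrix_eval (Matrix.of fun i j => x (i, j))]
  exact ⟨Matrix.GeneralLinearGroup.mkOfDetNeZero _ hA, left_ne_zero_of_mul hx⟩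

theorem IsZariskiOpen.exists_polynomial {U : Set (Matrix.GeneralLinearGroup (Fin d) k)}
    (hU : IsZariskiOpen U) (hne : U.Nonempty) : ∃ f : MvPolynomial (Fin d × Fin d) k, f ≠ 0 ∧
      ∀ γ : Matrix.GeneralLinearGroup (Fin d) k,
        eval (fun p => (γ : Matrix (Fin d) (Fin d) k) p.1 p.2) f ≠ 0 → γ ∈ U := by
  obtain ⟨S, rfl⟩ := hU
  obtain ⟨γ, f, hf, hfγ⟩ := hne
  exact ⟨f, fun h => hfγ (by rw [h, map_zero]), fun γ hγ => ⟨f, hf, hγ⟩⟩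

theorem IsZariskiOpen.inter_nonempty [Infinite k] {U V : Set (Matrix.GeneralLinearGroup (Fin d) k)}
    (hU : IsZariskiOpen U) (hU' : U.Nonempty) (hV : IsZariskiOpen V) (hV' : V.Nonempty) :
    (U ∩ V).Nonempty := by
  obtain ⟨f, hf, hfU⟩ := hU.exists_polynomial hU'
  obtain ⟨g, hg, hgV⟩ := hV.exists_polynomial hV'
  obtain ⟨γ, hγ⟩ := exists_generalLinearGroup_eval_ne_zero (mul_ne_zero hf hg)
  rw [map_mul] at hγ
  exact ⟨γ, hfU γ (left_ne_zero_of_mul hγ), hgV γ (right_ne_zero_of_mul hγ)⟩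

theorem sreg_eq_of_forall_mem [Infinite k] {I : Ideal (MvPolynomial (Fin d) k)} {i : ℕ} {r : EReal}
    {U : Set (Matrix.GeneralLinearGroup (Fin d) k)} (hU : IsZariskiOpen U) (hne : U.Nonempty)
    (h : ∀ γ ∈ U, regIdeal (sectionIdeal I (linForm γ) i) = r) : sreg I i = r := by
  obtain ⟨V, hV, hV', hVr⟩ := Classical.epsilon_spec (p := fun r : EReal =>
    ∃ U : Set (Matrix.GeneralLinearGroup (Fin d) k), IsZariskiOpen U ∧ U.Nonempty ∧
      ∀ γ ∈ U, regIdeal (sectionIdeal I (linForm γ) i) = r) ⟨r, U, hU, hne, h⟩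
  obtain ⟨γ, hγU, hγV⟩ := hU.inter_nonempty hne hV hV'
  exact (hVr γ hγV).symm.trans (h γ hγU)

variable {I : Ideal (MvPolynomial (Fin d) k)}

/-- The Hilbert functions of the section ideals are maximal on a nonempty open set. -/
theorem exists_isZariskiOpen_hilb [Infinite k]
    (hI : I.IsHomogeneous (homogeneousSubmodule (Fin d) k)) (N : ℕ) :
    ∃ U : Set (Matrix.GeneralLinearGroup (Fin d) k), IsZariskiOpen U ∧ U.Nonempty ∧
      ∀ γ ∈ U, ∀ γ' : Matrix.GeneralLinearGroup (Fin d) k, ∀ t n, t ≤ d → n ≤ N →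
        hilb (sectionIdeal I (linForm γ') t) n ≤ hilb (sectionIdeal I (linForm γ) t) n := by
  have hmax : ∀ t n, ∃ f : MvPolynomial (Fin d × Fin d) k, f ≠ 0 ∧
      ∀ γ : Matrix.GeneralLinearGroup (Fin d) k,
        eval (fun p => (γ : Matrix (Fin d) (Fin d) k) p.1 p.2) f ≠ 0 →
        ∀ γ' : Matrix.GeneralLinearGroup (Fin d) k,
        hilb (sectionIdeal I (linForm γ') t) n ≤ hilb (sectionIdeal I (linForm γ) t) n := by
    intro t n
    have hbdd : BddAbove (Set.range fun γ : Matrix.GeneralLinearGroup (Fin d) k =>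
        hilb (sectionIdeal I (linForm γ) t) n) := by
      refine ⟨Module.finrank k (homogeneousSubmodule (Fin d) k n), ?_⟩
      rintro _ ⟨γ, rfl⟩
      exact hilb_le _ _
    obtain ⟨γ₀, hγ₀⟩ := Nat.sSup_mem (Set.range_nonempty _) hbdd
    obtain ⟨f, hf, hfγ⟩ := exists_polynomial_hilb_le hI γ₀ t n
    refine ⟨f, hf, fun γ hγ γ' => le_trans ?_ (hfγ γ hγ)⟩
    exact (le_csSup hbdd ⟨γ', rfl⟩).trans hγ₀.symm.le
  choose f hf hfγ using hmax
  let F : MvPolynomial (Fin d × Fin d) k :=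
    ∏ t ∈ Finset.range (d + 1), ∏ n ∈ Finset.range (N + 1), f t n
  have hF : F ≠ 0 := Finset.prod_ne_zero_iff.mpr fun t _ => Finset.prod_ne_zero_iff.mpr
    fun n _ => hf t n
  refine ⟨_, ⟨{F}, rfl⟩, ?_, ?_⟩
  · obtain ⟨γ, hγ⟩ := exists_generalLinearGroup_eval_ne_zero hF
    exact ⟨γ, F, rfl, hγ⟩
  · rintro γ ⟨_, rfl, hγ⟩ γ' t n ht hn
    simp only [F, map_prod] at hγ
    have h1 := Finset.prod_ne_zero_iff.mp hγ t (Finset.mem_range.mpr (by omega))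
    exact hfγ t n γ (Finset.prod_ne_zero_iff.mp h1 n (Finset.mem_range.mpr (by omega))) γ'

theorem sectionIdeal_zero (hI : I.IsHomogeneous (homogeneousSubmodule (Fin d) k)) (htop : I ≠ ⊤)
    (γ : Matrix.GeneralLinearGroup (Fin d) k) :
    sectionIdeal I (linForm γ) 0 = idealOfVars (Fin d) k := by
  refine le_antisymm (sup_le (le_idealOfVars hI htop) ?_) (idealOfVars_le_sectionIdeal γ I)
  rw [← sectionIdeal_bot_zero γ]
  exact le_sup_right

/-- The slacks δ of `hilb_sectionIdeal_le` are nonnegative. Summed over t, their degree n + 1 terms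
telescope to the fixed ideals I and 𝔪, so only Hilbert functions in degree n matter. Larger ones
make the sum smaller; it is 0 at γ₀, hence 0 at γ. -/
theorem not_colonDefect_of_hilb_le (hI : I.IsHomogeneous (homogeneousSubmodule (Fin d) k))
    (htop : I ≠ ⊤) {γ γ₀ : Matrix.GeneralLinearGroup (Fin d) k} {n : ℕ}
    (h₀ : ∀ t, ¬ ColonDefect I (linForm γ₀) t n)
    (hle : ∀ t, t ≤ d → hilb (sectionIdeal I (linForm γ₀) t) n ≤
      hilb (sectionIdeal I (linForm γ) t) n) (t : Fin d) :
    ¬ ColonDefect I (linForm γ) t n := by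
  let h : Matrix.GeneralLinearGroup (Fin d) k → ℕ → ℕ → ℤ :=
    fun γ t n => hilb (sectionIdeal I (linForm γ) t) n
  let D : ℤ := Module.finrank k (homogeneousSubmodule (Fin d) k n)
  let δ : Matrix.GeneralLinearGroup (Fin d) k → ℕ → ℤ :=
    fun γ t => (h γ (t + 1) (n + 1) - h γ t (n + 1)) + (D - h γ (t + 1) n)
  have hsum : ∀ γ, ∑ t ∈ Finset.range d, δ γ t =
      (hilb I (n + 1) - hilb (idealOfVars (Fin d) k) (n + 1)) +
        ∑ t ∈ Finset.range d, (D - h γ (t + 1) n) := by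
    intro γ
    simp only [δ]
    rw [Finset.sum_add_distrib, Finset.sum_range_sub (fun t => h γ t (n + 1))]
    simp only [h]
    rw [sectionIdeal_of_le _ _ le_rfl, sectionIdeal_zero hI htop]
  have hδ : ∀ γ, ∀ t ∈ Finset.range d, 0 ≤ δ γ t := by
    intro γ t ht
    have := hilb_sectionIdeal_le hI γ ⟨t, Finset.mem_range.mp ht⟩ n
    simp only [δ, h, D]
    simp only at this
    omega
  have hδ₀ : ∑ t ∈ Finset.range d, δ γ₀ t = 0 := by
    refine Finset.sum_eq_zero fun t ht => ?_
    have := (not_colonDefect_iff hI γ₀ ⟨t, Finset.mem_range.mp ht⟩ n).mp (h₀ _)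
    simp only [δ, h, D]
    simp only at this
    omega
  have hδ₁ : ∑ t ∈ Finset.range d, δ γ t = 0 := by
    refine le_antisymm ?_ (Finset.sum_nonneg (hδ γ))
    rw [← hδ₀, hsum, hsum]
    refine add_le_add_right (Finset.sum_le_sum fun t ht => ?_) _
    have := hle (t + 1) (Finset.mem_range.mp ht)
    simp only [h]
    omega
  have := (Finset.sum_eq_zero_iff_of_nonneg (hδ γ)).mp hδ₁ t (Finset.mem_range.mpr t.2)
  rw [not_colonDefect_iff hI]
  simp only [δ, h, D] at this
  omega

/-- On a nonempty open set the coordinates are almost regular, with the same defects. -/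
theorem exists_isZariskiOpen_colonDefect [Infinite k]
    (hI : I.IsHomogeneous (homogeneousSubmodule (Fin d) k)) (htop : I ≠ ⊤) :
    ∃ U : Set (Matrix.GeneralLinearGroup (Fin d) k), IsZariskiOpen U ∧ U.Nonempty ∧
      ∀ γ ∈ U, IsAlmostRegular I (linForm γ) ∧ ∀ γ' ∈ U, ∀ t n,
        ColonDefect I (linForm γ) t n ↔ ColonDefect I (linForm γ') t n := by
  obtain ⟨γ₀, hγ₀⟩ := exists_isAlmostRegular hI
  rw [isAlmostRegular_iff hI (isHomogeneous_linForm γ₀)] at hγ₀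
  choose M hM using hγ₀
  obtain ⟨g, hg⟩ := exists_generatedUpTo hI
  -- Beyond the defects of γ₀ and within the range of persistence, which needs a positive bound for
  -- the generators.
  let m := max (Finset.univ.sup M) (g + 1)
  obtain ⟨U, hU, hne, hmax⟩ := exists_isZariskiOpen_hilb hI (m + 1)
  have hno : ∀ γ ∈ U, ∀ n, m ≤ n → ∀ t, ¬ ColonDefect I (linForm γ) t n := by
    intro γ hγ n hn
    refine not_colonDefect_of_le hI γ (hg.mono (Nat.le_succ g)) (Nat.le_add_left 1 g)
      (le_max_right _ _) (not_colonDefect_of_hilb_le hI htop (γ₀ := γ₀) (fun t => hM t m ?_)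
        fun t ht => hmax γ hγ γ₀ t m ht (Nat.le_succ m)) hn
    exact (Finset.le_sup (Finset.mem_univ t)).trans (le_max_left _ _)
  refine ⟨U, hU, hne, fun γ hγ => ⟨?_, fun γ' hγ' t n => ?_⟩⟩
  · rw [isAlmostRegular_iff hI (isHomogeneous_linForm γ)]
    exact fun t => ⟨m, fun n hn => hno γ hγ n hn t⟩
  · rcases le_or_gt m n with hn | hn
    · exact iff_of_false (hno γ hγ n hn t) (hno γ' hγ' n hn t)
    -- Both points attain the maximal Hilbert functions, and these determine the defects below m.
    · have heq : ∀ t n, t ≤ d → n ≤ m + 1 →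
          hilb (sectionIdeal I (linForm γ) t) n = hilb (sectionIdeal I (linForm γ') t) n :=
        fun t n ht hn => le_antisymm (hmax γ' hγ' γ t n ht hn) (hmax γ hγ γ' t n ht hn)
      rw [← not_iff_not, not_colonDefect_iff hI, not_colonDefect_iff hI,
        heq t (n + 1) t.2.le (by omega), heq (t + 1) n t.2 (by omega),
        heq (t + 1) (n + 1) t.2 (by omega)]

end GenericCoordinates

end SectReg

/-! ### The theorem -/

theorem mainTheorem3 {k : Type*} [Field k] [Infinite k] {d : ℕ}
    (I : Ideal (MvPolynomial (Fin d) k))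
    (hI : I.IsHomogeneous (MvPolynomial.homogeneousSubmodule (Fin d) k))
    (hbot : I ≠ ⊥) (htop : I ≠ ⊤) :
    (∃ U : Set (Matrix.GeneralLinearGroup (Fin d) k),
      SectReg.IsZariskiOpen U ∧ U.Nonempty ∧
      ∀ γ ∈ U, SectReg.IsAlmostRegular I (SectReg.linForm γ) ∧
        (∀ i : ℕ, i ≤ d →
          SectReg.sreg I i = SectReg.regIdeal (SectReg.sectionIdeal I (SectReg.linForm γ) i)) ∧
        (∀ i : ℕ, 1 ≤ i → i ≤ d → ∃ m : ℕ,
          SectReg.sreg I i = ((m : ℝ) : EReal) + 1 ∧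
          IsGreatest {r : EReal | ∃ t : Fin d, (t : ℕ) + 1 ≤ i ∧
            r = SectReg.reg d (SectReg.annGrading I (SectReg.linForm γ) t)} ((m : ℝ) : EReal) ∧
          IsGreatest {j : ℕ | ∃ s : Fin d, d - i ≤ (s : ℕ) ∧
            SectReg.annNumber I (SectReg.linForm γ) s j ≠ 0} m)) ∧
    (∀ γ : Matrix.GeneralLinearGroup (Fin d) k,
      SectReg.IsAlmostRegular I (SectReg.linForm γ) →
      ∀ i : ℕ, 1 ≤ i → i ≤ d → ∃ m : ℕ,
        SectReg.regIdeal (SectReg.sectionIdeal I (SectReg.linForm γ) i) =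
          ((m : ℝ) : EReal) + 1 ∧
        IsGreatest {r : EReal | ∃ t : Fin d, (t : ℕ) + 1 ≤ i ∧
          r = SectReg.reg d (SectReg.annGrading I (SectReg.linForm γ) t)} ((m : ℝ) : EReal) ∧
        IsGreatest {j : ℕ | ∃ s : Fin d, d - i ≤ (s : ℕ) ∧
          SectReg.annNumber I (SectReg.linForm γ) s j ≠ 0} m) ∧
    (∀ i j : ℕ, 1 ≤ i → i ≤ j → j ≤ d → SectReg.sreg I i ≤ SectReg.sreg I j) := by
  have part2 : ∀ γ : Matrix.GeneralLinearGroup (Fin d) k,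
      SectReg.IsAlmostRegular I (SectReg.linForm γ) →
      ∀ i : ℕ, 1 ≤ i → i ≤ d → ∃ m : ℕ,
        SectReg.regIdeal (SectReg.sectionIdeal I (SectReg.linForm γ) i) =
          ((m : ℝ) : EReal) + 1 ∧
        IsGreatest {n : ℕ | ∃ t : Fin d, (t : ℕ) + 1 ≤ i ∧
          SectReg.ColonDefect I (SectReg.linForm γ) t n} m := by
    intro γ hγ i hi hid
    obtain ⟨m, hm⟩ := SectReg.exists_isGreatest_colonDefect hI γ hbot htop hγ hi hid
    exact ⟨m, SectReg.regIdeal_sectionIdeal_eq hI γ hid hm, hm⟩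
  obtain ⟨U, hU, hne, hUE⟩ := SectReg.exists_isZariskiOpen_colonDefect hI htop
  have hsreg : ∀ γ ∈ U, ∀ i : ℕ, i ≤ d →
      SectReg.sreg I i = SectReg.regIdeal (SectReg.sectionIdeal I (SectReg.linForm γ) i) := by
    intro γ hγ i hid
    refine SectReg.sreg_eq_of_forall_mem hU hne fun γ' hγ' => ?_
    -- For i = 0 the section ideal is 𝔪 for every γ, and no maximum is involved.
    rcases Nat.eq_zero_or_pos i with rfl | hi
    · rw [SectReg.sectionIdeal_zero hI htop, SectReg.sectionIdeal_zero hI htop]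
    · obtain ⟨m, hm, hmg⟩ := part2 γ (hUE γ hγ).1 i hi hid
      simp only [(hUE γ hγ).2 γ' hγ'] at hmg
      rw [hm, SectReg.regIdeal_sectionIdeal_eq hI γ' hid hmg]
  refine ⟨⟨U, hU, hne, fun γ hγ => ⟨(hUE γ hγ).1, hsreg γ hγ, fun i hi hid => ?_⟩⟩, ?_, ?_⟩
  · obtain ⟨m, hm, hmg⟩ := part2 γ (hUE γ hγ).1 i hi hid
    exact ⟨m, (hsreg γ hγ i hid).trans hm, SectReg.isGreatest_reg_annGrading hmg,
      SectReg.isGreatest_annNumber hmg⟩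
  · intro γ hγ i hi hid
    obtain ⟨m, hm, hmg⟩ := part2 γ hγ i hi hid
    exact ⟨m, hm, SectReg.isGreatest_reg_annGrading hmg, SectReg.isGreatest_annNumber hmg⟩
  · intro i j hi hij hjd
    obtain ⟨γ, hγ⟩ := hne
    obtain ⟨m, hm, hmg⟩ := part2 γ (hUE γ hγ).1 i hi (hij.trans hjd)
    obtain ⟨m', hm', hmg'⟩ := part2 γ (hUE γ hγ).1 j (hi.trans hij) hjd
    rw [hsreg γ hγ i (hij.trans hjd), hsreg γ hγ j hjd, hm, hm']
    obtain ⟨t, ht, hE⟩ := hmg.1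
    have hle : m ≤ m' := hmg'.2 ⟨t, ht.trans hij, hE⟩
    gcongr
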